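/- Let $K$ be a field, $R=K[[x_1,\dots,x_n]]$ with maximal ideal $\mathfrak m$, and let $\mathrm{Aut}(R)$ be the group of $K$-algebra automorphisms of $R$ under composition, $(g\circ h)(f)=g(h(f))$. For ideals $J_1,\dots,J_s$ of $R$ let $G(J_1,\dots,J_s)=\{g\in\mathrm{Aut}(R): g(J_k)=J_k \text{ for all } k\}$. Let $I_1,\dots,I_r$ be monomial ideals of finite colength in $R$. For $1\le i\le n$ let $A_i$ be the ideal generated by the images $g(x_i)$ of $x_i$ under all $g\in G(I_1,\dots,I_r)$ with $g(x_j)=x_j$ for every $j\ne i$. Let $$\mathfrak m^2\subsetneq B_1\subsetneq\dots\subsetneq B_m=\mathfrak m$$ be a nested sequence of monomial ideals with $G(A_1,\dots,A_n)\subset G(B_1,\dots,B_m)$, where $m\geq 1$ is the largest possible among all such sequences, and put $G(B)=G(B_1,\dots,B_m)$. Write $x_j\le x_i$ if every $B_k$ containing $x_i$ contains $x_j$, and $x_j<x_i$ if $x_j\le x_i$ but not $x_i\le x_j$. Let $\mathcal I$ be the set of pairs $(i,v)$, with $1\le i\le n$ and $v\in\mathbb Z_{\ge 0}^n$, such that $x^v\notin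 A_i$ and such that, if $|v|=1$, then $x^v<x_i$. Let $\mathcal S$ be the set of automorphisms $g\in\mathrm{Aut}(R)$ for which there are $a_{i,v}\in K$ (finitely many nonzero) such that $$g(x_i)=x_i+\sum_{v:\,(i,v)\in\mathcal I}a_{i,v}\,x^v\qquad\text{for } i=1,\dots,n.$$ Then $\mathcal S$ is a set of representatives for the cosets $f\circ G(A_1,\dots,A_n)$, $f\in G(B)$: we have $\mathcal S\subset G(B)$, and for every $f\in G(B)$ there is exactly one $g\in\mathcal S$ such that $f=g\circ h$ for some $h\in G(A_1,\dots,A_n)$. -/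

import Mathlib

open MvPowerSeries

namespace Alignment

/-- The formal power series ring `R = K[[x_1, …, x_n]]`. -/
abbrev PS (n : ℕ) (K : Type*) [Field K] : Type _ := MvPowerSeries (Fin n) K

/-- The group `Aut(R)` of `K`-algebra automorphisms of `R`; the product is composition,
`(g * h) f = g (h f)`. -/
abbrev Aut (n : ℕ) (K : Type*) [Field K] : Type _ := PS n K ≃ₐ[K] PS n K

section

variable {n : ℕ} {K : Type*} [Field K]

/-- The monomial `x^v`. -/
noncomputable def mono (K : Type*) [Field K] (v : Fin n →₀ ℕ) : PS n K := monomial v 1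

/-- Ideals generated by monomials. -/
def IsMonomial (J : Ideal (PS n K)) : Prop :=
  ∃ T : Set (Fin n →₀ ℕ), J = Ideal.span (mono K '' T)

/-- The automorphism `g` sends the ideal `J` onto itself. -/
def Fixes (g : Aut n K) (J : Ideal (PS n K)) : Prop :=
  J.map (g : PS n K →+* PS n K) = J

/-- The group `G(J_1, …, J_s)` of automorphisms of `R` fixing each of the ideals `J_k`. -/
noncomputable def G {ι : Type*} (J : ι → Ideal (PS n K)) : Subgroup (Aut n K) where
  carrier := {g | ∀ k, Fixes g (J k)}
  one_mem' := fun k => Ideal.map_id (J k)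
  mul_mem' := by
    intro a b ha hb k
    have h := Ideal.map_map (I := J k) (b : PS n K →+* PS n K) (a : PS n K →+* PS n K)
    have hb' : (J k).map (b : PS n K →+* PS n K) = J k := hb k
    have ha' : (J k).map (a : PS n K →+* PS n K) = J k := ha k
    rw [hb', ha'] at h
    exact h.symm
  inv_mem' := by
    intro a ha k
    have h := Ideal.map_map (I := J k) (a : PS n K →+* PS n K)
      ((a⁻¹ : Aut n K) : PS n K →+* PS n K)
    have ha' : (J k).map (a : PS n K →+* PS n K) = J k := ha k
    have hc : ((a⁻¹ : Aut n K) : PS n K →+* PS n K).comp (a : PS n K →+* PS n K)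
        = RingHom.id _ := by
      ext1 x
      exact a.symm_apply_apply x
    rw [ha', hc, Ideal.map_id] at h
    exact h

/-- The measuring sequence `A_1, …, A_n` of the ideals `I_1, …, I_r`: the ideal `A_i` is generated
by the images of `x_i` under the automorphisms of `R` which fix every `x_j` with `j ≠ i` and send
each `I_k` to itself. -/
noncomputable def measuring {r : ℕ} (I : Fin r → Ideal (PS n K)) (i : Fin n) : Ideal (PS n K) :=
  Ideal.span {f | ∃ g : Aut n K, (∀ j, j ≠ i → g (X j) = X j) ∧ (∀ k, Fixes g (I k)) ∧ g (X i) = f}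

/-- A nested sequence `𝔪² ⊊ B_0 ⊊ ⋯ ⊊ B_m = 𝔪` of monomial ideals such that
`G(A_1, …, A_n) ⊆ G(B_0, …, B_m)`. -/
structure IsChain (A : Fin n → Ideal (PS n K)) {m : ℕ} (B : Fin (m + 1) → Ideal (PS n K)) :
    Prop where
  isMonomial : ∀ k, IsMonomial (B k)
  sq_lt : IsLocalRing.maximalIdeal (PS n K) ^ 2 < B 0
  strictMono : StrictMono B
  last_eq : B (Fin.last m) = IsLocalRing.maximalIdeal (PS n K)
  le : G A ≤ G B

/-- Such a nested sequence with the greatest possible number of terms. -/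
structure IsMaxChain (A : Fin n → Ideal (PS n K)) {m : ℕ} (B : Fin (m + 1) → Ideal (PS n K)) :
    Prop extends IsChain A B where
  maximal : ∀ (m' : ℕ) (B' : Fin (m' + 1) → Ideal (PS n K)), IsChain A B' → m' ≤ m

/-- The (non-strict) total ordering on the variables given by the chain `B`:
`x_i ≤ x_j` when each `B_k` that contains `x_j` contains `x_i`. -/
def VarLE {ι : Type*} (B : ι → Ideal (PS n K)) (i j : Fin n) : Prop :=
  ∀ k, (X j : PS n K) ∈ B k → (X i : PS n K) ∈ B k

/-- `x_i < x_j`: `x_i ≤ x_j` and the two variables are not equivalent. -/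
def VarLT {ι : Type*} (B : ι → Ideal (PS n K)) (i j : Fin n) : Prop :=
  VarLE B i j ∧ ¬ VarLE B j i

/-- The set of pairs `(i, v)` such that `x^v ∉ A_i` and, if `|v| = 1`, so that `x^v` is a
variable `x_j`, then `x_j < x_i`. -/
def pairs {ι : Type*} (A : Fin n → Ideal (PS n K)) (B : ι → Ideal (PS n K)) :
    Set (Fin n × (Fin n →₀ ℕ)) :=
  {q | mono K q.2 ∉ A q.1 ∧ ∀ j, q.2 = Finsupp.single j 1 → VarLT B j q.1}

/-- The set of automorphisms `g` of the form `g(x_i) = x_i + ∑ a_{i,v} x^v`, where for each `i` the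
sum runs over the `v` with `(i, v) ∈ pairs A B`. -/
def reps {ι : Type*} (A : Fin n → Ideal (PS n K)) (B : ι → Ideal (PS n K)) : Set (Aut n K) :=
  {g | ∃ a : Fin n → (Fin n →₀ ℕ) →₀ K,
    (∀ i, ∀ v ∈ (a i).support, (i, v) ∈ pairs A B) ∧
    ∀ i, g (X i) = X i + (a i).sum fun v c => c • mono K v}

end

end Alignment

/-!
The ideals `A_i` are monomial, and an automorphism moving only `x_i` lies in `G(A)` as soon as it
sends `x_i` into `A_i`. If `x_i` and `x_j` are equivalent, then `x_j ∈ A_i`, because otherwise the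
chain `B` could be refined. Hence every invertible matrix that is block diagonal for the equivalence
classes of the variables is the linear part of an element of `G(A)`, and each `f ∈ G(B)` is `u ∘ p`
with `p ∈ G(A)` and `u` unipotent: `u(x_i) - x_i` has larger weight than `x_i`, for weights that
grow as the variables get smaller.

For unipotent `u`, the endomorphism of the vector space `A_i` that sends `b` to the sum of the
terms of `u(b)` whose monomials lie in `A_i` is the identity up to terms of larger weight, hence
bijective. Let `b_i` be the element it sends to the sum of the terms of `u(x_i) - x_i` lying in
`A_i`. The automorphism `k` given by `x_i ↦ x_i - b_i` is in `G(A)`, and `u ∘ k` is the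
representative of the coset of `f`. It is unique because the endomorphisms are injective.
-/

namespace Alignment

variable {n : ℕ} {K : Type*} [Field K]

/-! ### Monomial ideals -/

theorem mono_zero : mono K (0 : Fin n →₀ ℕ) = 1 := rfl

theorem mono_single_one (i : Fin n) : mono K (Finsupp.single i 1) = X i := rfl

theorem mono_add (u v : Fin n →₀ ℕ) : mono K (u + v) = mono K u * mono K v := by
  simp only [mono, monomial_mul_monomial, mul_one]

theorem mono_eq_prod (v : Fin n →₀ ℕ) : mono K v = ∏ i, X i ^ v i := by
  rw [mono, monomial_one_eq, Finsupp.prod_fintype _ _ fun i => pow_zero _]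

theorem coeff_mono_self (v : Fin n →₀ ℕ) : coeff v (mono K v) = 1 :=
  coeff_monomial_same v 1

theorem eq_of_coeff_mono_ne_zero {u v : Fin n →₀ ℕ} (h : coeff u (mono K v) ≠ 0) : u = v := by
  classical
  by_contra huv
  exact h (coeff_monomial_ne huv 1)

theorem mono_dvd_iff {v : Fin n →₀ ℕ} {f : PS n K} :
    mono K v ∣ f ↔ ∀ u, coeff u f ≠ 0 → v ≤ u := by
  classical
  constructor
  · rintro ⟨q, rfl⟩ u hu
    by_contra hvu
    exact hu (by rw [mono, coeff_monomial_mul, if_neg hvu])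
  · intro h
    let q : PS n K := fun u => coeff (u + v) f
    refine ⟨q, ?_⟩
    ext u
    rw [mono, coeff_monomial_mul, one_mul]
    split_ifs with hvu
    · change _ = coeff (u - v + v) f
      rw [tsub_add_cancel_of_le hvu]
    · exact not_not.1 (mt (h u) hvu)

theorem mono_mem_of_le {J : Ideal (PS n K)} {u v : Fin n →₀ ℕ} (h : u ≤ v) (hu : mono K u ∈ J) :
    mono K v ∈ J := by
  rw [← tsub_add_cancel_of_le h, mono_add]
  exact J.mul_mem_left _ hu

open Classical in
/-- The part of a power series supported on a set `S` of exponents. -/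
noncomputable def restrict (S : Set (Fin n →₀ ℕ)) : PS n K →ₗ[K] PS n K where
  toFun f v := if v ∈ S then coeff v f else 0
  map_add' f g := funext fun v => by
    change _ = (if v ∈ S then coeff v f else 0) + if v ∈ S then coeff v g else 0
    split_ifs <;> simp
  map_smul' c f := funext fun v => by
    change _ = c * if v ∈ S then coeff v f else 0
    split_ifs <;> simp

section restrict

variable {S : Set (Fin n →₀ ℕ)} {v : Fin n →₀ ℕ} {f : PS n K}

theorem coeff_restrict_of_mem (hv : v ∈ S) : coeff v (restrict S f) = coeff v f :=
  if_pos hv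

theorem coeff_restrict_of_notMem (hv : v ∉ S) : coeff v (restrict S f) = 0 :=
  if_neg hv

theorem coeff_restrict_ne_zero_iff : coeff v (restrict S f) ≠ 0 ↔ v ∈ S ∧ coeff v f ≠ 0 := by
  by_cases hv : v ∈ S
  · simp only [coeff_restrict_of_mem hv, hv, true_and]
  · simp only [coeff_restrict_of_notMem hv, hv, false_and, ne_eq, not_true_eq_false]

theorem coeff_sub_restrict_ne_zero_iff :
    coeff v (f - restrict S f) ≠ 0 ↔ v ∉ S ∧ coeff v f ≠ 0 := by
  rw [map_sub]
  by_cases hv : v ∈ S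
  · simp [coeff_restrict_of_mem hv, hv]
  · simp [coeff_restrict_of_notMem hv, hv]

theorem restrict_eq_restrict_iff {g : PS n K} :
    restrict S f = restrict S g ↔ ∀ v ∈ S, coeff v f = coeff v g := by
  refine ⟨fun h v hv => ?_, fun h => ?_⟩
  · rw [← coeff_restrict_of_mem hv, h, coeff_restrict_of_mem hv]
  · ext v
    by_cases hv : v ∈ S
    · rw [coeff_restrict_of_mem hv, coeff_restrict_of_mem hv, h v hv]
    · rw [coeff_restrict_of_notMem hv, coeff_restrict_of_notMem hv]

theorem restrict_eq_self_iff : restrict S f = f ↔ ∀ v, coeff v f ≠ 0 → v ∈ S := by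
  refine ⟨fun h v hv => (coeff_restrict_ne_zero_iff.1 (h ▸ hv)).1, fun h => ?_⟩
  ext v
  by_cases hv : v ∈ S
  · rw [coeff_restrict_of_mem hv]
  · rw [coeff_restrict_of_notMem hv, not_not.1 (mt (h v) hv)]

theorem restrict_restrict : restrict S (restrict S f) = restrict S f :=
  restrict_eq_self_iff.2 fun _ hv => (coeff_restrict_ne_zero_iff.1 hv).1

theorem restrict_eq_sum (hS : S.Finite) (f : PS n K) :
    restrict S f = ∑ v ∈ hS.toFinset, coeff v f • mono K v := by
  classical
  ext u
  rw [map_sum]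
  simp only [map_smul, mono, coeff_monomial, smul_eq_mul, mul_ite, mul_one, mul_zero,
    Finset.sum_ite_eq, Set.Finite.mem_toFinset]
  rfl

end restrict

theorem mem_span_mono_of_finite {T : Set (Fin n →₀ ℕ)} (hT : T.Finite) :
    ∀ f : PS n K, (∀ v, coeff v f ≠ 0 → ∃ t ∈ T, t ≤ v) → f ∈ Ideal.span (mono K '' T) := by
  induction T, hT using Set.Finite.induction_on with
  | empty =>
    intro f hf
    have : f = 0 := by
      ext v
      by_contra h
      simpa using hf v h
    exact this ▸ zero_mem _
  | @insert t T _ _ ih =>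
    intro f hf
    rw [Set.image_insert_eq, ← add_sub_cancel (restrict {v | t ≤ v} f) f]
    refine add_mem (Ideal.mem_of_dvd _ (mono_dvd_iff.2 fun v hv => ?_)
      (Ideal.subset_span (Set.mem_insert _ _)))
      (Ideal.span_mono (Set.subset_insert _ _) (ih _ fun v hv => ?_))
    · exact (coeff_restrict_ne_zero_iff.1 hv).1
    · obtain ⟨htv, hv⟩ := coeff_sub_restrict_ne_zero_iff.1 hv
      obtain ⟨s, rfl | hs, hsv⟩ := hf v hv
      · exact absurd hsv htv
      · exact ⟨s, hs, hsv⟩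

-- The minimal exponents form an antichain, hence a finite set (Dickson's lemma).
theorem mem_span_mono {T : Set (Fin n →₀ ℕ)} {f : PS n K} :
    f ∈ Ideal.span (mono K '' T) ↔ ∀ v, coeff v f ≠ 0 → ∃ t ∈ T, t ≤ v := by
  classical
  constructor
  · intro hf
    induction hf using Submodule.span_induction with
    | mem _ h =>
      obtain ⟨t, ht, rfl⟩ := h
      exact fun v hv => ⟨t, ht, (eq_of_coeff_mono_ne_zero hv).ge⟩
    | zero => exact fun v hv => absurd (coeff_zero v) hv
    | add f g _ _ hf hg =>
      intro v hv
      by_cases h : coeff v f = 0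
      · exact hg v (by simpa [h] using hv)
      · exact hf v h
    | smul a f _ hf =>
      intro v hv
      rw [smul_eq_mul, coeff_mul] at hv
      obtain ⟨p, hp, hne⟩ := Finset.exists_ne_zero_of_sum_ne_zero hv
      obtain ⟨t, ht, htp⟩ := hf p.2 (right_ne_zero_of_mul hne)
      exact ⟨t, ht, htp.trans (Finset.HasAntidiagonal.mem_antidiagonal.1 hp ▸ le_add_self)⟩
  · intro hf
    have hfin : {t | Minimal (· ∈ T) t}.Finite :=
      (setOfPred_minimal_antichain _).finite_of_wellQuasiOrdered WellQuasiOrderedLE.wqo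
    refine Ideal.span_mono (Set.image_mono fun t ht => ht.prop)
      (mem_span_mono_of_finite hfin f fun v hv => ?_)
    obtain ⟨t, ht, htv⟩ := hf v hv
    obtain ⟨s, hst, hs⟩ := exists_minimal_le_of_wellFoundedLT (· ∈ T) t ht
    exact ⟨s, hs, hst.trans htv⟩

theorem mono_mem_span_mono {T : Set (Fin n →₀ ℕ)} {v : Fin n →₀ ℕ} :
    mono K v ∈ Ideal.span (mono K '' T) ↔ ∃ t ∈ T, t ≤ v := by
  rw [mem_span_mono]
  exact ⟨fun h => h v (by simp [coeff_mono_self]),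
    fun h u hu => eq_of_coeff_mono_ne_zero hu ▸ h⟩

theorem IsMonomial.mem_iff {J : Ideal (PS n K)} (hJ : IsMonomial J) {f : PS n K} :
    f ∈ J ↔ ∀ v, coeff v f ≠ 0 → mono K v ∈ J := by
  obtain ⟨T, rfl⟩ := hJ
  rw [mem_span_mono]
  exact forall₂_congr fun v _ => mono_mem_span_mono.symm

theorem IsMonomial.eq_span {J : Ideal (PS n K)} (hJ : IsMonomial J) :
    J = Ideal.span (mono K '' {v | mono K v ∈ J}) := by
  ext f
  rw [hJ.mem_iff, mem_span_mono]
  exact forall₂_congr fun v _ =>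
    ⟨fun h => ⟨v, h, le_rfl⟩, fun ⟨_, ht, htv⟩ => mono_mem_of_le htv ht⟩

theorem IsMonomial.map_mem {J J' : Ideal (PS n K)} (hJ : IsMonomial J) (φ : PS n K →+* PS n K)
    (h : ∀ v, mono K v ∈ J → φ (mono K v) ∈ J') {f : PS n K} (hf : f ∈ J) : φ f ∈ J' := by
  suffices J ≤ J'.comap φ from this hf
  rw [hJ.eq_span, Ideal.span_le]
  rintro _ ⟨v, hv, rfl⟩
  exact h v hv

theorem isMonomial_bot : IsMonomial (⊥ : Ideal (PS n K)) :=
  ⟨∅, by rw [Set.image_empty, Ideal.span_empty]⟩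

/-! ### Ideals fixed by an automorphism -/

theorem Fixes.map_mem {g : Aut n K} {J : Ideal (PS n K)} (h : Fixes g J) {f : PS n K}
    (hf : f ∈ J) : g f ∈ J :=
  (show J.map (g : PS n K →+* PS n K) = J from h) ▸ Ideal.mem_map_of_mem _ hf

-- The ideals `g⁻ᵏ J` increase with `k`, so they are eventually constant.
theorem fixes_of_forall_mem {g : Aut n K} {J : Ideal (PS n K)} (h : ∀ f ∈ J, g f ∈ J) :
    Fixes g J := by
  refine le_antisymm (Ideal.map_le_iff_le_comap.2 h) fun y hy => ?_
  let s : ℕ →o Ideal (PS n K) :=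
    { toFun := fun k => J.comap ((g ^ k : Aut n K) : PS n K →+* PS n K)
      monotone' := monotone_nat_of_le_succ fun k f hf => by
        change (g ^ (k + 1)) f ∈ J
        rw [pow_succ']
        exact h _ hf }
  obtain ⟨N, hN⟩ := monotone_stabilizes_iff_noetherian.2
    (inferInstance : IsNoetherian (PS n K) (PS n K)) s
  have h_succ : (g ^ (N + 1))⁻¹ y ∈ s (N + 1) := by
    change (g ^ (N + 1) * (g ^ (N + 1))⁻¹) y ∈ J
    rwa [mul_inv_cancel]
  rw [← hN (N + 1) N.le_succ] at h_succ
  have hy' : g⁻¹ y ∈ J := by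
    rw [show g⁻¹ = g ^ N * (g ^ (N + 1))⁻¹ by group]
    exact h_succ
  have := Ideal.mem_map_of_mem (g : PS n K →+* PS n K) hy'
  rwa [show (g : PS n K →+* PS n K) (g⁻¹ y) = y from g.apply_symm_apply y] at this

/-! ### The maximal ideal and endomorphisms -/

/-- The ideal of power series all of whose terms have weight at least `d`, where the variable
`x_i` has weight `w i`. -/
noncomputable def weightIdeal (w : Fin n → ℕ) (d : ℕ) : Ideal (PS n K) :=
  Ideal.span (mono K '' {v | d ≤ Finsupp.weight w v})

section weightIdeal

variable {w : Fin n → ℕ} {d e : ℕ} {f g : PS n K}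

theorem isMonomial_weightIdeal : IsMonomial (weightIdeal w d : Ideal (PS n K)) := ⟨_, rfl⟩

theorem mem_weightIdeal :
    f ∈ weightIdeal w d ↔ ∀ v, coeff v f ≠ 0 → d ≤ Finsupp.weight w v := by
  rw [weightIdeal, mem_span_mono]
  refine forall₂_congr fun v _ => ⟨?_, fun h => ⟨v, h, le_rfl⟩⟩
  rintro ⟨t, ht, htv⟩
  rw [← tsub_add_cancel_of_le htv, map_add]
  exact le_add_left ht

theorem mono_mem_weightIdeal {v : Fin n →₀ ℕ} :
    mono K v ∈ weightIdeal w d ↔ d ≤ Finsupp.weight w v := by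
  rw [mem_weightIdeal]
  exact ⟨fun h => h v (by simp [coeff_mono_self]),
    fun h u hu => eq_of_coeff_mono_ne_zero hu ▸ h⟩

theorem weightIdeal_antitone : Antitone (weightIdeal w : ℕ → Ideal (PS n K)) :=
  fun _ _ h => Ideal.span_mono (Set.image_mono fun _ hv => h.trans hv)

theorem mul_mem_weightIdeal (hf : f ∈ weightIdeal w d) (hg : g ∈ weightIdeal w e) :
    f * g ∈ weightIdeal w (d + e) := by
  classical
  rw [mem_weightIdeal] at *
  intro v hv
  rw [coeff_mul] at hv
  obtain ⟨p, hp, hne⟩ := Finset.exists_ne_zero_of_sum_ne_zero hv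
  rw [← Finset.HasAntidiagonal.mem_antidiagonal.1 hp, map_add]
  exact add_le_add (hf _ (left_ne_zero_of_mul hne)) (hg _ (right_ne_zero_of_mul hne))

theorem weightIdeal_zero : (weightIdeal w 0 : Ideal (PS n K)) = ⊤ :=
  (Ideal.eq_top_iff_one _).2 <| mem_weightIdeal.2 fun _ _ => zero_le

end weightIdeal

open IsLocalRing (maximalIdeal)

theorem mem_maximalIdeal {f : PS n K} : f ∈ maximalIdeal (PS n K) ↔ constantCoeff f = 0 := by
  rw [IsLocalRing.mem_maximalIdeal, mem_nonunits_iff, isUnit_iff_constantCoeff,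
    isUnit_iff_ne_zero, not_not]

theorem maximalIdeal_pow (d : ℕ) : maximalIdeal (PS n K) ^ d = weightIdeal (fun _ => 1) d := by
  apply le_antisymm
  · induction d with
    | zero => rw [weightIdeal_zero]; exact le_top
    | succ d ih =>
      rw [pow_succ]
      refine Ideal.mul_le.2 fun f hf g hg => mul_mem_weightIdeal (ih hf) ?_
      refine mem_weightIdeal.2 fun v hv => ?_
      rw [← Finsupp.degree_eq_weight_one, Nat.one_le_iff_ne_zero, Ne, Finsupp.degree_eq_zero_iff]
      rintro rfl
      exact hv (mem_maximalIdeal.1 hg)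
  · refine Ideal.span_le.2 ?_
    rintro _ ⟨v, hv, rfl⟩
    rw [Set.mem_ofPred_eq, ← Finsupp.degree_eq_weight_one] at hv
    refine Ideal.pow_le_pow_right hv ?_
    rw [mono_eq_prod, Finsupp.degree_eq_sum, ← Finset.prod_pow_eq_pow_sum]
    exact Ideal.prod_mem_prod fun i _ =>
      Ideal.pow_mem_pow (mem_maximalIdeal.2 (constantCoeff_X i)) _

theorem mem_maximalIdeal_pow {d : ℕ} {f : PS n K} :
    f ∈ maximalIdeal (PS n K) ^ d ↔ ∀ v, coeff v f ≠ 0 → d ≤ v.degree := by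
  rw [maximalIdeal_pow, mem_weightIdeal, Finsupp.degree_eq_weight_one]

theorem eq_zero_or_single_of_degree_lt_two {v : Fin n →₀ ℕ} (hv : v.degree < 2) :
    v = 0 ∨ ∃ j, v = Finsupp.single j 1 := by
  obtain h | h : v.degree = 0 ∨ v.degree = 1 := by omega
  · exact Or.inl (Finsupp.degree_eq_zero_iff v |>.1 h)
  · obtain ⟨j, hj⟩ := Finsupp.range_single_one.ge h
    exact Or.inr ⟨j, hj.symm⟩

section AlgHom

variable {F : Type*} [FunLike F (PS n K) (PS n K)] [AlgHomClass F K (PS n K) (PS n K)]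

theorem constantCoeff_algHom (φ : F) (f : PS n K) :
    constantCoeff (φ f) = constantCoeff f := by
  by_contra h
  set c := constantCoeff (φ f) with hc
  have hu : IsUnit (f - algebraMap K (PS n K) c) := by
    rw [isUnit_iff_constantCoeff, isUnit_iff_ne_zero, map_sub, sub_ne_zero]
    simpa [MvPowerSeries.algebraMap_apply] using Ne.symm h
  have := hu.map φ
  rw [isUnit_iff_constantCoeff, map_sub, AlgHomClass.commutes, map_sub, ← hc] at this
  simp [MvPowerSeries.algebraMap_apply] at this

theorem algHom_mem_maximalIdeal_pow (φ : F) {d : ℕ} {f : PS n K}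
    (hf : f ∈ maximalIdeal (PS n K) ^ d) : φ f ∈ maximalIdeal (PS n K) ^ d := by
  refine Ideal.pow_right_mono (fun _ hg => ?_) d (Ideal.map_pow φ (maximalIdeal _) d ▸
    Ideal.mem_map_of_mem φ hf)
  refine (Ideal.map_le_iff_le_comap.2 fun g hg => ?_) hg
  rw [Ideal.mem_comap, mem_maximalIdeal, constantCoeff_algHom]
  exact mem_maximalIdeal.1 hg

theorem algHom_mono_sub_mem {φ ψ : F} {J : Ideal (PS n K)} {v : Fin n →₀ ℕ}
    (h : ∀ i ∈ v.support, φ (X i) - ψ (X i) ∈ J) : φ (mono K v) - ψ (mono K v) ∈ J := by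
  simp only [← Ideal.Quotient.eq, mono_eq_prod, map_prod, map_pow] at h ⊢
  refine Finset.prod_congr rfl fun i _ => ?_
  by_cases hi : v i = 0
  · rw [hi, pow_zero, pow_zero]
  · rw [h i (Finsupp.mem_support_iff.2 hi)]

-- Endomorphisms preserve every power of `𝔪`, so each coefficient of `φ f - ψ f` only depends on
-- finitely many terms of `f`.
theorem algHom_sub_mem {φ ψ : F} {J : Ideal (PS n K)} (hJ : IsMonomial J) {f : PS n K}
    (h : ∀ v, coeff v f ≠ 0 → ∀ i ∈ v.support, φ (X i) - ψ (X i) ∈ J) : φ f - ψ f ∈ J := by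
  refine hJ.mem_iff.2 fun v hv => ?_
  let S : Set (Fin n →₀ ℕ) := {u | u.degree < v.degree + 1}
  have hS : S.Finite := Finsupp.finite_of_degree_lt _
  have h_tail : f - restrict S f ∈ maximalIdeal (PS n K) ^ (v.degree + 1) :=
    mem_maximalIdeal_pow.2 fun u hu => not_lt.1 (coeff_sub_restrict_ne_zero_iff.1 hu).1
  have h_coeff : coeff v (φ (f - restrict S f) - ψ (f - restrict S f)) = 0 := by
    by_contra hne
    have := mem_maximalIdeal_pow.1 (sub_mem (algHom_mem_maximalIdeal_pow φ h_tail)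
      (algHom_mem_maximalIdeal_pow ψ h_tail)) v hne
    omega
  have h_head : φ (restrict S f) - ψ (restrict S f) ∈ J := by
    simp only [restrict_eq_sum hS, map_sum, map_smul, ← Finset.sum_sub_distrib, ← smul_sub]
    refine sum_mem fun u _ => ?_
    by_cases hu : coeff u f = 0
    · rw [hu, zero_smul]
      exact zero_mem _
    · exact Submodule.smul_of_tower_mem J _ (algHom_mono_sub_mem (h u hu))
  refine hJ.mem_iff.1 h_head v ?_
  rw [map_sub φ, map_sub ψ, sub_sub_sub_comm, map_sub, sub_eq_zero] at h_coeff
  rwa [← h_coeff]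

theorem algHom_eq_of_X {φ ψ : F} {f : PS n K}
    (h : ∀ v, coeff v f ≠ 0 → ∀ i ∈ v.support, φ (X i) = ψ (X i)) : φ f = ψ f :=
  sub_eq_zero.1 <| (Submodule.mem_bot _).1 <| algHom_sub_mem isMonomial_bot
    fun v hv i hi => (Submodule.mem_bot _).2 (sub_eq_zero.2 (h v hv i hi))

theorem algHom_ext_X {φ ψ : F} (h : ∀ i, φ (X i) = ψ (X i)) : φ = ψ :=
  DFunLike.ext _ _ fun _ => algHom_eq_of_X fun _ _ i _ => h i

end AlgHom

theorem fixes_of_X_sub_mem {g : Aut n K} {J : Ideal (PS n K)} (hJ : IsMonomial J)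
    (h : ∀ i, g (X i) - X i ∈ J) : Fixes g J := by
  refine fixes_of_forall_mem fun f hf => ?_
  have : g f - f ∈ J := algHom_sub_mem (ψ := (1 : Aut n K)) hJ fun _ _ i _ => h i
  simpa using add_mem this hf

/-! ### Unipotent automorphisms -/

section Unipotent

variable {w : Fin n → ℕ} {d : ℕ}

theorem eq_zero_of_forall_mem_weightIdeal {f : PS n K} (h : ∀ d, f ∈ weightIdeal w d) : f = 0 := by
  ext v
  by_contra hv
  exact (mem_weightIdeal.1 (h (Finsupp.weight w v + 1)) v hv).not_gt (Nat.lt_succ_self _)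

theorem constantCoeff_of_mem_weightIdeal (hd : 0 < d) {f : PS n K} (hf : f ∈ weightIdeal w d) :
    constantCoeff f = 0 := by
  by_contra h
  exact hd.not_ge (by simpa using mem_weightIdeal.1 hf 0 h)

theorem restrict_mem_weightIdeal {S : Set (Fin n →₀ ℕ)} {f : PS n K} (hf : f ∈ weightIdeal w d) :
    restrict S f ∈ weightIdeal w d :=
  mem_weightIdeal.2 fun v hv => mem_weightIdeal.1 hf v (coeff_restrict_ne_zero_iff.1 hv).2

section RaisesWeight

variable {L : PS n K →ₗ[K] PS n K}

theorem mem_weightIdeal_of_map_mem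
    (hL : ∀ d, ∀ f ∈ weightIdeal w d, L f - f ∈ weightIdeal w (d + 1)) {f : PS n K}
    (hf : L f ∈ weightIdeal w d) : f ∈ weightIdeal w d := by
  suffices ∀ k ≤ d, f ∈ weightIdeal w k from this d le_rfl
  intro k
  induction k with
  | zero => exact fun _ => weightIdeal_zero (K := K) (w := w) ▸ Submodule.mem_top
  | succ k ih =>
    intro hk
    have := sub_mem (weightIdeal_antitone hk hf) (hL k f (ih (by omega)))
    rwa [sub_sub_cancel] at this

theorem injective_of_sub_mem (hL : ∀ d, ∀ f ∈ weightIdeal w d, L f - f ∈ weightIdeal w (d + 1)) :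
    Function.Injective L :=
  (injective_iff_map_eq_zero L).2 fun _ hf => eq_zero_of_forall_mem_weightIdeal fun _ =>
    mem_weightIdeal_of_map_mem hL (hf ▸ zero_mem _)

-- The preimage of `y` is the limit of the iteration `a ↦ a + (y - L a)`.
theorem surjective_of_sub_mem (hL : ∀ d, ∀ f ∈ weightIdeal w d, L f - f ∈ weightIdeal w (d + 1)) :
    Function.Surjective L := by
  intro y
  let a : ℕ → PS n K := fun k => (fun a => a + (y - L a))^[k] 0
  have a_succ (k : ℕ) : a (k + 1) = a k + (y - L (a k)) := Function.iterate_succ_apply' _ _ _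
  have h_err (k : ℕ) : y - L (a k) ∈ weightIdeal w k := by
    induction k with
    | zero => exact weightIdeal_zero (K := K) (w := w) ▸ Submodule.mem_top
    | succ k ih =>
      rw [a_succ, map_add, ← sub_sub, ← neg_sub (L _) (y - _)]
      exact neg_mem (hL k _ ih)
  have h_cauchy {k l : ℕ} (hkl : k ≤ l) : a l - a k ∈ weightIdeal w k := by
    induction l, hkl using Nat.le_induction with
    | base => exact sub_self (a k) ▸ zero_mem _
    | succ l hkl ih =>
      rw [a_succ, add_sub_right_comm]
      exact add_mem ih (weightIdeal_antitone hkl (h_err l))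
  let b : PS n K := fun v => coeff v (a (Finsupp.weight w v + 1))
  have h_lim (k : ℕ) : b - a k ∈ weightIdeal w k := by
    refine mem_weightIdeal.2 fun v hv => ?_
    by_contra! hlt
    have h_stable : coeff v (a (Finsupp.weight w v + 1)) = coeff v (a k) := by
      by_contra hne
      have h_diff : coeff v (a k - a (Finsupp.weight w v + 1)) ≠ 0 := by
        rw [map_sub]
        exact sub_ne_zero.2 (Ne.symm hne)
      exact (mem_weightIdeal.1 (h_cauchy hlt) v h_diff).not_gt (Nat.lt_succ_self _)
    exact hv ((map_sub (coeff v) _ _).trans (sub_eq_zero.2 h_stable))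
  refine ⟨b, sub_eq_zero.1 <| eq_zero_of_forall_mem_weightIdeal (w := w) fun k => ?_⟩
  have h_eq : L b - y = (L (b - a k) - (b - a k)) + (b - a k) - (y - L (a k)) := by
    rw [map_sub]
    ring
  rw [h_eq]
  exact sub_mem (add_mem (weightIdeal_antitone k.le_succ (hL k _ (h_lim k))) (h_lim k)) (h_err k)

end RaisesWeight

section AlgHom

variable {F : Type*} [FunLike F (PS n K) (PS n K)] [AlgHomClass F K (PS n K) (PS n K)] {φ : F}

theorem algHom_mono_sub_mem_weightIdeal
    (hφ : ∀ i, φ (X i) - X i ∈ weightIdeal w (w i + 1)) (v : Fin n →₀ ℕ) :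
    φ (mono K v) - mono K v ∈ weightIdeal w (Finsupp.weight w v + 1) := by
  have h_add (u v : Fin n →₀ ℕ)
      (hu : φ (mono K u) - mono K u ∈ weightIdeal w (Finsupp.weight w u + 1))
      (hv : φ (mono K v) - mono K v ∈ weightIdeal w (Finsupp.weight w v + 1)) :
      φ (mono K (u + v)) - mono K (u + v) ∈ weightIdeal w (Finsupp.weight w (u + v) + 1) := by
    have hu' : φ (mono K u) ∈ weightIdeal w (Finsupp.weight w u) := by
      have := add_mem (weightIdeal_antitone (Nat.le_succ _) hu) (mono_mem_weightIdeal.2 le_rfl)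
      rwa [sub_add_cancel] at this
    have h_eq : φ (mono K (u + v)) - mono K (u + v) =
        φ (mono K u) * (φ (mono K v) - mono K v) + mono K v * (φ (mono K u) - mono K u) := by
      rw [mono_add, map_mul]
      ring
    rw [h_eq, map_add]
    refine add_mem ?_ ?_
    · rw [add_assoc]
      exact mul_mem_weightIdeal hu' hv
    · rw [add_comm (Finsupp.weight w u), add_assoc]
      exact mul_mem_weightIdeal (mono_mem_weightIdeal.2 le_rfl) hu
  induction v using Finsupp.induction_linear with
  | zero => simp [mono_zero]
  | add u v hu hv => exact h_add u v hu hv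
  | single i k =>
    induction k with
    | zero => simp [mono_zero]
    | succ k ih =>
      rw [Finsupp.single_add]
      refine h_add _ _ ih ?_
      simpa [mono_single_one, Finsupp.weight_single] using hφ i

theorem algHom_sub_mem_weightIdeal (hφ : ∀ i, φ (X i) - X i ∈ weightIdeal w (w i + 1))
    {f : PS n K} (hf : f ∈ weightIdeal w d) : φ f - f ∈ weightIdeal w (d + 1) := by
  induction hf using Submodule.span_induction with
  | mem _ h =>
    obtain ⟨v, hv, rfl⟩ := h
    exact weightIdeal_antitone (Nat.succ_le_succ hv) (algHom_mono_sub_mem_weightIdeal hφ v)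
  | zero => simp
  | add f g _ _ hf hg =>
    rw [map_add, add_sub_add_comm]
    exact add_mem hf hg
  | smul a f hf ih =>
    have ha : φ a - a ∈ weightIdeal w 1 := algHom_sub_mem (φ := AlgHomClass.toAlgHom φ)
      (ψ := AlgHom.id K _) isMonomial_weightIdeal
      fun _ _ i _ => weightIdeal_antitone (Nat.le_add_left 1 _) (hφ i)
    have h_eq : φ (a • f) - a • f = φ a * (φ f - f) + (φ a - a) * f := by
      simp only [smul_eq_mul, map_mul]
      ring
    rw [h_eq, add_comm d]
    exact add_mem (add_comm d 1 ▸ Ideal.mul_mem_left _ _ ih) (mul_mem_weightIdeal ha hf)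

end AlgHom

/-- The group of automorphisms that change each `x_i` by terms of weight greater than `w i`, where
the variable `x_j` has weight `w j`. -/
noncomputable def unipotent (K : Type*) [Field K] (w : Fin n → ℕ) : Subgroup (Aut n K) where
  carrier := {g | ∀ i, g (X i) - X i ∈ weightIdeal w (w i + 1)}
  one_mem' i := by simp
  mul_mem' {g h} hg hh i := by
    have hX : h (X i) ∈ weightIdeal w (w i) := by
      have := add_mem (weightIdeal_antitone (Nat.le_succ _) (hh i))
        (mono_mem_weightIdeal (v := Finsupp.single i 1)
          |>.2 (by simp [Finsupp.weight_single]))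
      rwa [mono_single_one, sub_add_cancel] at this
    have := add_mem (algHom_sub_mem_weightIdeal hg hX) (hh i)
    rwa [sub_add_sub_cancel] at this
  inv_mem' {g} hg i := by
    refine mem_weightIdeal_of_map_mem (L := g.toLinearMap)
      (fun d f hf => algHom_sub_mem_weightIdeal hg hf) ?_
    have : g.toLinearMap (g⁻¹ (X i) - X i) = -(g (X i) - X i) := by
      rw [map_sub, neg_sub]
      exact congrArg (· - g (X i)) (g.apply_symm_apply (X i))
    exact this ▸ neg_mem (hg i)

theorem mem_unipotent {g : Aut n K} :
    g ∈ unipotent K w ↔ ∀ i, g (X i) - X i ∈ weightIdeal w (w i + 1) := Iff.rfl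

theorem sub_mem_of_mem_unipotent {g : Aut n K} (hg : g ∈ unipotent K w) {f : PS n K}
    (hf : f ∈ weightIdeal w d) : g f - f ∈ weightIdeal w (d + 1) :=
  algHom_sub_mem_weightIdeal hg hf

theorem exists_mem_unipotent {a : Fin n → PS n K}
    (ha : ∀ i, a i - X i ∈ weightIdeal w (w i + 1)) :
    ∃ g ∈ unipotent K w, ∀ i, g (X i) = a i := by
  have h_subst : HasSubst a := hasSubst_of_constantCoeff_zero fun i => by
    have := constantCoeff_of_mem_weightIdeal (Nat.succ_pos _) (ha i)
    rwa [map_sub, constantCoeff_X, sub_zero] at this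
  let φ : PS n K →ₐ[K] PS n K := substAlgHom h_subst
  have hφX (i : Fin n) : φ (X i) = a i := by rw [substAlgHom_apply, subst_X h_subst]
  have hφ (d : ℕ) (f : PS n K) (hf : f ∈ weightIdeal w d) :
      φ.toLinearMap f - f ∈ weightIdeal w (d + 1) :=
    algHom_sub_mem_weightIdeal (φ := φ) (fun i => hφX i ▸ ha i) hf
  let g : Aut n K := AlgEquiv.ofBijective φ ⟨injective_of_sub_mem hφ, surjective_of_sub_mem hφ⟩
  exact ⟨g, fun i => (hφX i).symm ▸ ha i, hφX⟩

/-- The endomorphism `f ↦ f - π f + π (g (π f))`, where `π` is the projection onto the terms whose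
monomials lie in `J`. It compresses `g` to the monomial ideal `J`, and is the identity on the
complement. -/
noncomputable def compression (g : Aut n K) (J : Ideal (PS n K)) : PS n K →ₗ[K] PS n K :=
  let π := restrict {v | mono K v ∈ J}
  LinearMap.id - π + π ∘ₗ g.toLinearMap ∘ₗ π

theorem compression_sub_mem_weightIdeal {g : Aut n K} (hg : g ∈ unipotent K w) (J : Ideal (PS n K))
    (d : ℕ) (f : PS n K) (hf : f ∈ weightIdeal w d) :
    compression g J f - f ∈ weightIdeal w (d + 1) := by
  set S := {v | mono K v ∈ J}
  have h_eq : compression g J f - f = restrict S (g (restrict S f) - restrict S f) := by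
    ext v
    by_cases hv : v ∈ S <;>
      simp [compression, S, hv, coeff_restrict_of_mem, coeff_restrict_of_notMem]
  rw [h_eq]
  exact restrict_mem_weightIdeal (sub_mem_of_mem_unipotent hg (restrict_mem_weightIdeal hf))

theorem compression_eq_restrict_iff {g : Aut n K} {J : Ideal (PS n K)} (hJ : IsMonomial J)
    {b y : PS n K} : compression g J b = restrict {v | mono K v ∈ J} y ↔
      b ∈ J ∧ ∀ v, mono K v ∈ J → coeff v (g b) = coeff v y := by
  set π : PS n K →ₗ[K] PS n K := restrict {v | mono K v ∈ J}
  have hJπ : π b = b ↔ b ∈ J := restrict_eq_self_iff.trans hJ.mem_iff.symm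
  have h_def : compression g J b = b - π b + π (g (π b)) := rfl
  rw [← hJπ, h_def]
  constructor
  · intro h
    have h_range : b - π b = π (y - g (π b)) := by rw [map_sub, ← h, add_sub_cancel_right]
    have h_ker : π (b - π b) = 0 := by rw [map_sub, restrict_restrict, sub_self]
    have hb : b - π b = 0 := by rw [h_range, ← restrict_restrict, ← h_range, h_ker]
    rw [hb, zero_add, ← sub_eq_zero.1 hb] at h
    exact ⟨(sub_eq_zero.1 hb).symm, restrict_eq_restrict_iff.1 h⟩
  · rintro ⟨hb, h⟩
    rw [hb, sub_self, zero_add]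
    exact restrict_eq_restrict_iff.2 h

theorem existsUnique_coeff_apply_eq {g : Aut n K} (hg : g ∈ unipotent K w) {J : Ideal (PS n K)}
    (hJ : IsMonomial J) (y : PS n K) :
    ∃! b, b ∈ J ∧ ∀ v, mono K v ∈ J → coeff v (g b) = coeff v y := by
  have hL := compression_sub_mem_weightIdeal hg J
  simp only [← compression_eq_restrict_iff hJ]
  exact Function.Bijective.existsUnique ⟨injective_of_sub_mem hL, surjective_of_sub_mem hL⟩ _

theorem mem_weightIdeal_of_coeff_apply_eq {g : Aut n K} (hg : g ∈ unipotent K w)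
    {J : Ideal (PS n K)} (hJ : IsMonomial J) {b y : PS n K} (hb : b ∈ J)
    (hby : ∀ v, mono K v ∈ J → coeff v (g b) = coeff v y) (hy : y ∈ weightIdeal w d) :
    b ∈ weightIdeal w d := by
  refine mem_weightIdeal_of_map_mem (compression_sub_mem_weightIdeal hg J) ?_
  rw [(compression_eq_restrict_iff hJ).2 ⟨hb, hby⟩]
  exact restrict_mem_weightIdeal hy

end Unipotent

/-! ### Automorphisms moving one variable -/

/-- The group of automorphisms fixing every variable other than `x_i`. -/
noncomputable def varGroup (K : Type*) [Field K] (i : Fin n) : Subgroup (Aut n K) :=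
  fixingSubgroup (Aut n K) ((X : Fin n → PS n K) '' {i}ᶜ)

theorem mem_varGroup {i : Fin n} {g : Aut n K} :
    g ∈ varGroup K i ↔ ∀ j, j ≠ i → g (X j) = X j := by
  simp [varGroup, mem_fixingSubgroup_iff]

/-- The subalgebra of power series that do not involve `x_i`. -/
noncomputable def freeSubalgebra (K : Type*) [Field K] (i : Fin n) : Subalgebra K (PS n K) where
  carrier := {f | ∀ v, coeff v f ≠ 0 → v i = 0}
  mul_mem' {f g} hf hg v hv := by
    classical
    rw [coeff_mul] at hv
    obtain ⟨p, hp, hne⟩ := Finset.exists_ne_zero_of_sum_ne_zero hv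
    rw [← Finset.HasAntidiagonal.mem_antidiagonal.1 hp, Finsupp.add_apply,
      hf _ (left_ne_zero_of_mul hne), hg _ (right_ne_zero_of_mul hne)]
  add_mem' {f g} hf hg v hv := by
    by_cases h : coeff v f = 0
    · exact hg v (by simpa [h] using hv)
    · exact hf v h
  algebraMap_mem' c v hv := by
    classical
    by_contra h
    refine hv ?_
    rw [MvPowerSeries.algebraMap_apply, coeff_C, if_neg (by rintro rfl; exact h rfl)]

section VarGroup

variable {i : Fin n} {g t : Aut n K} {f h : PS n K} {v : Fin n →₀ ℕ}

theorem mono_mem_freeSubalgebra : mono K v ∈ freeSubalgebra K i ↔ v i = 0 :=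
  ⟨fun h => h v (by simp [coeff_mono_self]), fun h u hu => eq_of_coeff_mono_ne_zero hu ▸ h⟩

theorem apply_eq_self_of_mem_freeSubalgebra (hg : g ∈ varGroup K i)
    (hf : f ∈ freeSubalgebra K i) : g f = f :=
  algHom_eq_of_X (ψ := (1 : Aut n K)) fun v hv j hj => mem_varGroup.1 hg j <| by
    rintro rfl
    exact Finsupp.mem_support_iff.1 hj (hf v hv)

theorem varGroup_ext (hg : g ∈ varGroup K i) (ht : t ∈ varGroup K i)
    (h : g (X i) = t (X i)) : g = t :=
  algHom_ext_X fun j => by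
    by_cases hj : j = i
    · rw [hj, h]
    · rw [mem_varGroup.1 hg j hj, mem_varGroup.1 ht j hj]

theorem exists_apply_X_eq_smul {c : Fin n → K} (hc : ∀ i, c i ≠ 0) :
    ∃ g : Aut n K, ∀ i, g (X i) = c i • X i := by
  have h_mul : c * c⁻¹ = 1 := funext fun i => mul_inv_cancel₀ (hc i)
  have h_inv (b b' : Fin n → K) (hb : b * b' = 1) :
      (rescaleAlgHom b).comp (rescaleAlgHom b') = AlgHom.id K (PS n K) := by
    rw [← rescaleAlgHom_mul, mul_comm, hb, rescaleAlgHom_one]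
  refine ⟨AlgEquiv.ofAlgHom (rescaleAlgHom c) (rescaleAlgHom c⁻¹) (h_inv _ _ h_mul)
    (h_inv _ _ (mul_comm c _ ▸ h_mul)), fun i => ?_⟩
  ext v
  rw [AlgEquiv.ofAlgHom_apply, rescaleAlgHom_apply, coeff_rescale, coeff_smul, coeff_X]
  split_ifs with hv
  · simp [hv]
  · simp

theorem exists_mem_varGroup_smul_X (i : Fin n) {c : K} (hc : c ≠ 0) :
    ∃ g ∈ varGroup K i, g (X i) = c • X i := by
  classical
  obtain ⟨g, hg⟩ := exists_apply_X_eq_smul (c := Function.update 1 i c) fun j => by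
    by_cases hj : j = i
    · simpa [hj] using hc
    · simp [hj]
  exact ⟨g, mem_varGroup.2 fun j hj => by simp [hg, hj], by simp [hg]⟩

-- Give `x_i` weight `1` and the other variables weight `2`: up to a scalar, such an automorphism
-- is unipotent.
theorem exists_mem_varGroup (h0 : constantCoeff f = 0) (hi : coeff (Finsupp.single i 1) f ≠ 0) :
    ∃ g ∈ varGroup K i, g (X i) = f := by
  classical
  set c := coeff (Finsupp.single i 1) f with hc
  let w : Fin n → ℕ := fun j => if j = i then 1 else 2
  have hw (j : Fin n) : 1 ≤ w j := by grind
  have h_unip : c⁻¹ • f - X i ∈ weightIdeal w 2 := by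
    refine mem_weightIdeal.2 fun v hv => ?_
    by_contra! hlt
    have h_deg : v.degree < 2 := by
      refine lt_of_le_of_lt ?_ hlt
      rw [Finsupp.weight_eq_sum, Finsupp.degree_eq_sum]
      exact Finset.sum_le_sum fun j _ => Nat.le_mul_of_pos_right _ (hw j)
    refine hv ?_
    obtain rfl | ⟨j, rfl⟩ := eq_zero_or_single_of_degree_lt_two h_deg
    · simp [h0]
    · obtain rfl : j = i := by
        by_contra hj
        simp [w, hj, Finsupp.weight_single] at hlt
      simp [← hc, hi]
  obtain ⟨u, -, huX⟩ := exists_mem_unipotent (w := w) (a := Function.update X i (c⁻¹ • f))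
    fun j => by
      by_cases hj : j = i
      · subst hj
        simpa [w] using h_unip
      · simp [hj]
  obtain ⟨s, hs, hsX⟩ := exists_mem_varGroup_smul_X i hi
  refine ⟨u * s, mul_mem (mem_varGroup.2 fun j hj => by simp [huX, hj]) hs, ?_⟩
  rw [AlgEquiv.mul_apply, hsX, map_smul, huX, Function.update_self, smul_inv_smul₀ hi]

end VarGroup

/-! ### Transvections -/

theorem inv_apply_X {i : Fin n} {g : Aut n K} {h : PS n K} (hg : g ∈ varGroup K i)
    (hh : h ∈ freeSubalgebra K i) (hgX : g (X i) = X i + h) : g⁻¹ (X i) = X i - h := by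
  apply g.injective
  rw [map_sub, hgX, apply_eq_self_of_mem_freeSubalgebra hg hh, add_sub_cancel_right]
  exact g.apply_symm_apply _

/-- The power series `h` not involving `x_i` such that `H` contains the automorphism adding `h` to
`x_i` and fixing the other variables. -/
noncomputable def transvections (H : Subgroup (Aut n K)) (i : Fin n) : AddSubgroup (PS n K) where
  carrier := {h | h ∈ freeSubalgebra K i ∧ ∃ g ∈ H ⊓ varGroup K i, g (X i) = X i + h}
  zero_mem' := ⟨zero_mem _, 1, one_mem _, (add_zero _).symm⟩
  add_mem' := by
    rintro h h' ⟨hh, g, hg, hgX⟩ ⟨hh', g', hg', hgX'⟩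
    refine ⟨add_mem hh hh', g * g', mul_mem hg hg', ?_⟩
    rw [AlgEquiv.mul_apply, hgX', map_add, hgX, apply_eq_self_of_mem_freeSubalgebra hg.2 hh',
      add_assoc]
  neg_mem' := by
    rintro h ⟨hh, g, hg, hgX⟩
    exact ⟨neg_mem hh, g⁻¹, inv_mem hg, by rw [inv_apply_X hg.2 hh hgX, sub_eq_add_neg]⟩

section Transvections

variable {i : Fin n} {g : Aut n K} {h : PS n K} {v : Fin n →₀ ℕ}

theorem coeff_single_of_mem_freeSubalgebra (hh : h ∈ freeSubalgebra K i) :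
    coeff (Finsupp.single i 1) h = 0 := by
  by_contra hne
  simpa using hh _ hne

theorem exists_mem_varGroup_add (hh : h ∈ freeSubalgebra K i) (h0 : constantCoeff h = 0) :
    ∃ g ∈ varGroup K i, g (X i) = X i + h :=
  exists_mem_varGroup (by simp [h0]) (by simp [coeff_single_of_mem_freeSubalgebra hh])

theorem constantCoeff_of_mem_transvections {H : Subgroup (Aut n K)} (hh : h ∈ transvections H i) :
    constantCoeff h = 0 := by
  obtain ⟨-, g, -, hgX⟩ := hh
  simpa [hgX] using constantCoeff_algHom g (X i)

theorem apply_mono_of_mem_varGroup (hg : g ∈ varGroup K i) (hgX : g (X i) = X i + h)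
    (a : Fin n →₀ ℕ) : g (mono K a) = ∑ k ∈ Finset.range (a i + 1),
      ((a i).choose k : K) • (h ^ k * mono K (a - Finsupp.single i k)) := by
  have h_split (b : Fin n →₀ ℕ) : mono K b = X i ^ b i * mono K (b.erase i) := by
    rw [X_pow_eq, ← mono, ← mono_add, Finsupp.single_add_erase]
  have h_free : mono K (a.erase i) ∈ freeSubalgebra K i :=
    mono_mem_freeSubalgebra.2 Finsupp.erase_same
  rw [h_split a, map_mul, map_pow, hgX, apply_eq_self_of_mem_freeSubalgebra hg h_free, add_comm,
    add_pow, Finset.sum_mul]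
  refine Finset.sum_congr rfl fun k _ => ?_
  have h_erase : (a - Finsupp.single i k).erase i = a.erase i := by
    ext j
    by_cases hj : j = i <;> simp [hj]
  rw [h_split (a - Finsupp.single i k), h_erase, Finsupp.tsub_apply, Finsupp.single_eq_same,
    Nat.cast_smul_eq_nsmul, nsmul_eq_mul]
  ring

/-- The combinatorial condition on an exponent `v` not involving `x_i` under which the automorphism
`x_i ↦ x_i + x^v` fixes the ideals `I_k`: each monomial occurring in the image of a monomial of
`I_k` lies in `I_k`. -/
def Admissible {ι : Type*} (I : ι → Ideal (PS n K)) (i : Fin n) (v : Fin n →₀ ℕ) : Prop :=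
  ∀ (k : ι) (a : Fin n →₀ ℕ) (l : ℕ), mono K a ∈ I k → ((a i).choose l : K) ≠ 0 →
    mono K (a - Finsupp.single i l + l • v) ∈ I k

variable {ι : Type*} {I : ι → Ideal (PS n K)}

theorem Admissible.of_le {u : Fin n →₀ ℕ} (hu : Admissible I i u) (huv : u ≤ v) :
    Admissible I i v := fun k a l ha hl =>
  mono_mem_of_le (add_le_add_right (nsmul_le_nsmul_right huv l) _) (hu k a l ha hl)

theorem admissible_of_forall_mono_mem (h : ∀ k, mono K v ∈ I k) : Admissible I i v := by
  intro k a l ha _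
  obtain rfl | hl := Nat.eq_zero_or_pos l
  · simpa using ha
  · refine mono_mem_of_le (le_add_left ?_) (h k)
    simpa using nsmul_le_nsmul_left (zero_le (a := v)) hl

theorem smul_mono_mem_transvections (hI : ∀ k, IsMonomial (I k)) (hi : v i = 0) (h0 : v ≠ 0)
    (hv : Admissible I i v) (c : K) : c • mono K v ∈ transvections (G I) i := by
  have h_free : c • mono K v ∈ freeSubalgebra K i :=
    Subalgebra.smul_mem _ (mono_mem_freeSubalgebra.2 hi) c
  have h_const : constantCoeff (c • mono K v) = 0 := by
    classical
    rw [← coeff_zero_eq_constantCoeff_apply, coeff_smul, mono, coeff_monomial_ne h0.symm, mul_zero]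
  obtain ⟨g, hg, hgX⟩ := exists_mem_varGroup_add h_free h_const
  refine ⟨h_free, g, ⟨fun k => fixes_of_forall_mem fun f hf => ?_, hg⟩, hgX⟩
  refine (hI k).map_mem (g : PS n K →+* PS n K) (fun a ha => ?_) hf
  change g (mono K a) ∈ I k
  rw [apply_mono_of_mem_varGroup hg hgX]
  refine sum_mem fun l _ => ?_
  by_cases hl : ((a i).choose l : K) = 0
  · rw [hl, zero_smul]
    exact zero_mem _
  · have h_eq : (c • mono K v) ^ l * mono K (a - Finsupp.single i l) =
        c ^ l • mono K (a - Finsupp.single i l + l • v) := by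
      rw [smul_pow, smul_mul_assoc, add_comm, mono_add, mono, monomial_pow, one_pow, ← mono]
    rw [h_eq]
    exact Submodule.smul_of_tower_mem _ _ (Submodule.smul_of_tower_mem _ _ (hv k a l ha hl))

-- Modulo each power of `𝔪`, the automorphism `x_i ↦ x_i + h` is a finite product of automorphisms
-- `x_i ↦ x_i + c x^v`.
theorem mem_transvections_of_admissible (hI : ∀ k, IsMonomial (I k))
    (hh : h ∈ freeSubalgebra K i) (h0 : constantCoeff h = 0)
    (hadm : ∀ v, coeff v h ≠ 0 → Admissible I i v) : h ∈ transvections (G I) i := by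
  obtain ⟨g, hg, hgX⟩ := exists_mem_varGroup_add hh h0
  refine ⟨hh, g, ⟨fun k => fixes_of_forall_mem fun f hf => ?_, hg⟩, hgX⟩
  refine (hI k).map_mem (g : PS n K →+* PS n K) (fun a ha => (hI k).mem_iff.2 fun u hu => ?_) hf
  have h_trunc : restrict {v | v.degree < u.degree + 1} h ∈ transvections (G I) i := by
    rw [restrict_eq_sum (Finsupp.finite_of_degree_lt _)]
    refine sum_mem fun v _ => ?_
    by_cases hv : coeff v h = 0
    · rw [hv, zero_smul]
      exact zero_mem _
    · exact smul_mono_mem_transvections hI (hh v hv) (by rintro rfl; exact hv h0) (hadm v hv) _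
  obtain ⟨-, t, ⟨htI, ht⟩, htX⟩ := h_trunc
  have h_near : g (mono K a) - t (mono K a) ∈ maximalIdeal _ ^ (u.degree + 1) := by
    refine algHom_mono_sub_mem fun j _ => ?_
    by_cases hj : j = i
    · rw [hj, hgX, htX, add_sub_add_left_eq_sub, mem_maximalIdeal_pow]
      exact fun v hv => not_lt.1 (coeff_sub_restrict_ne_zero_iff.1 hv).1
    · rw [mem_varGroup.1 hg j hj, mem_varGroup.1 ht j hj, sub_self]
      exact zero_mem _
  refine (hI k).mem_iff.1 ((htI k).map_mem ha) u fun hu' => hu ?_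
  change coeff u (g (mono K a)) = 0
  by_contra hne
  have := mem_maximalIdeal_pow.1 h_near u (by rwa [map_sub, hu', sub_zero])
  omega

theorem lexOrder_pow (hv : lexOrder h = toLex v) (k : ℕ) : lexOrder (h ^ k) = toLex (k • v) := by
  induction k with
  | zero =>
    rw [pow_zero, zero_smul]
    refine le_antisymm (lexOrder_le_of_coeff_ne_zero (by simp)) (le_lexOrder_iff.2 fun d hd => ?_)
    exact absurd (WithTop.coe_lt_coe.1 hd) (not_lt.2 (Finsupp.toLex_monotone zero_le))
  | succ k ih =>
    rw [pow_succ, lexOrder_mul, ih, hv, succ_nsmul]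
    rfl

-- In the image of `x^a`, the monomial `x_i^(a_i - l) x^(l v)` times the part of `x^a` not involving
-- `x_i` can only come from the term `h^l`, whose leading monomial is `x^(l v)`.
theorem admissible_of_lexOrder_eq (hI : ∀ k, IsMonomial (I k)) (hh : h ∈ transvections (G I) i)
    (hv : lexOrder h = toLex v) : Admissible I i v := by
  obtain ⟨hfree, g, ⟨hgI, hg⟩, hgX⟩ := hh
  intro k a l ha hl
  have hvi : v i = 0 := hfree v (coeff_ne_zero_of_lexOrder hv.symm)
  have hla : l ≤ a i := by
    by_contra! hlt
    exact hl (by rw [Nat.choose_eq_zero_of_lt hlt, Nat.cast_zero])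
  refine (hI k).mem_iff.1 ((hgI k).map_mem ha) _ ?_
  rw [apply_mono_of_mem_varGroup hg hgX, map_sum, Finset.sum_eq_single l]
  · rw [coeff_smul, mono, coeff_mul_monomial, if_pos (le_add_right le_rfl), add_tsub_cancel_left,
      mul_one]
    exact mul_ne_zero hl (coeff_ne_zero_of_lexOrder (lexOrder_pow hv l).symm)
  · intro m hm hml
    by_contra hne
    rw [coeff_smul, mono, coeff_mul_monomial] at hne
    obtain ⟨hle, hne⟩ := ite_ne_right_iff.1 (right_ne_zero_of_mul hne)
    have h_exp := pow_mem hfree m _ (left_ne_zero_of_mul hne)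
    have hle_i := hle i
    rw [Finset.mem_range] at hm
    simp only [Finsupp.tsub_apply, Finsupp.add_apply, Finsupp.smul_apply, Finsupp.single_eq_same,
      hvi, smul_zero, add_zero] at h_exp hle_i
    omega
  · exact fun hl' => absurd (Finset.mem_range.2 (Nat.lt_succ_of_le hla)) hl'

theorem mem_transvections_iff_admissible (hI : ∀ k, IsMonomial (I k)) :
    h ∈ transvections (G I) i ↔ h ∈ freeSubalgebra K i ∧ constantCoeff h = 0 ∧
      ∀ v, coeff v h ≠ 0 → Admissible I i v := by
  refine ⟨fun hh => ⟨hh.1, constantCoeff_of_mem_transvections hh, ?_⟩,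
    fun ⟨hfree, h0, hadm⟩ => mem_transvections_of_admissible hI hfree h0 hadm⟩
  set S := {v | Admissible I i v}
  have h_adm : restrict S h ∈ transvections (G I) i := by
    refine mem_transvections_of_admissible hI
      (fun v hv => hh.1 v (coeff_restrict_ne_zero_iff.1 hv).2) ?_
      fun v hv => (coeff_restrict_ne_zero_iff.1 hv).1
    by_contra h0
    exact (coeff_restrict_ne_zero_iff.1 h0).2 (constantCoeff_of_mem_transvections hh)
  have h_zero : h - restrict S h = 0 := by
    by_contra hne
    obtain ⟨v, hv⟩ := exists_finsupp_eq_lexOrder_of_ne_zero hne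
    exact (coeff_sub_restrict_ne_zero_iff.1 (coeff_ne_zero_of_lexOrder hv.symm)).1
      (admissible_of_lexOrder_eq hI (sub_mem hh h_adm) hv)
  exact restrict_eq_self_iff.1 (sub_eq_zero.1 h_zero).symm

theorem mono_mem_transvections_iff (hI : ∀ k, IsMonomial (I k)) :
    mono K v ∈ transvections (G I) i ↔ v i = 0 ∧ v ≠ 0 ∧ Admissible I i v := by
  rw [mem_transvections_iff_admissible hI, mono_mem_freeSubalgebra]
  refine and_congr_right fun _ => and_congr ?_
    ⟨fun h => h v (by simp [coeff_mono_self]), fun h u hu => eq_of_coeff_mono_ne_zero hu ▸ h⟩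
  refine ⟨?_, fun h0 => not_not.1 fun hne => h0 (eq_of_coeff_mono_ne_zero hne).symm⟩
  rintro h rfl
  simp [mono_zero] at h

theorem mem_transvections_iff_mono (hI : ∀ k, IsMonomial (I k)) :
    h ∈ transvections (G I) i ↔ ∀ v, coeff v h ≠ 0 → mono K v ∈ transvections (G I) i := by
  simp only [mono_mem_transvections_iff hI]
  rw [mem_transvections_iff_admissible hI]
  constructor
  · rintro ⟨hfree, h0, hadm⟩ v hv
    exact ⟨hfree v hv, by rintro rfl; exact hv h0, hadm v hv⟩
  · intro H
    refine ⟨fun v hv => (H v hv).1, ?_, fun v hv => (H v hv).2.2⟩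
    by_contra h0
    exact (H 0 h0).2.1 rfl

theorem mono_mem_transvections_of_le (hI : ∀ k, IsMonomial (I k)) {u : Fin n →₀ ℕ}
    (hu : mono K u ∈ transvections (G I) i) (huv : u ≤ v) (hi : v i = 0) :
    mono K v ∈ transvections (G I) i := by
  rw [mono_mem_transvections_iff hI] at hu ⊢
  exact ⟨hi, fun h0 => hu.2.1 (le_zero_iff.1 (h0 ▸ huv)), hu.2.2.of_le huv⟩

theorem fixes_of_dvd {J : Ideal (PS n K)} (hJ : IsMonomial J) (h : ∀ j, X j ∣ g (X j)) :
    Fixes g J := by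
  refine fixes_of_forall_mem fun f hf =>
    hJ.map_mem (g : PS n K →+* PS n K) (fun a ha => J.mem_of_dvd ?_ ha) hf
  change mono K a ∣ g (mono K a)
  simp only [mono_eq_prod, map_prod, map_pow]
  exact Finset.prod_dvd_prod_of_dvd _ _ fun j _ => pow_dvd_pow_of_dvd (h j) _

end Transvections

theorem mem_G_iff_restrict_mem_transvections {ι : Type*} {I : ι → Ideal (PS n K)}
    (hI : ∀ k, IsMonomial (I k)) {i : Fin n} {g : Aut n K} (hg : g ∈ varGroup K i) :
    g ∈ G I ↔ restrict {v | v i = 0} (g (X i)) ∈ transvections (G I) i := by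
  set h := restrict {v | v i = 0} (g (X i))
  have hh : h ∈ freeSubalgebra K i := fun v hv => (coeff_restrict_ne_zero_iff.1 hv).1
  have h0 : constantCoeff h = 0 := by
    by_contra hne
    exact (coeff_restrict_ne_zero_iff.1 hne).2 (by simpa using constantCoeff_algHom g (X i))
  obtain ⟨t, ht, htX⟩ := exists_mem_varGroup_add hh h0
  have h_dvd : g * t⁻¹ ∈ G I := fun k => fixes_of_dvd (hI k) fun j => by
    by_cases hj : j = i
    · rw [hj, AlgEquiv.mul_apply, inv_apply_X ht hh htX, map_sub,
        apply_eq_self_of_mem_freeSubalgebra hg hh, ← mono_single_one, mono_dvd_iff]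
      intro v hv
      rw [Finsupp.single_le_iff, Nat.one_le_iff_ne_zero]
      exact (coeff_sub_restrict_ne_zero_iff.1 hv).1
    · rw [mem_varGroup.1 (mul_mem hg (inv_mem ht)) j hj]
  have h_iff : g ∈ G I ↔ t ∈ G I := by
    have h := Subgroup.mul_mem_cancel_left (G I) h_dvd (y := t)
    rwa [inv_mul_cancel_right] at h
  rw [h_iff]
  refine ⟨fun htI => ⟨hh, t, ⟨htI, ht⟩, htX⟩, fun ⟨_, s, ⟨hsI, hs⟩, hsX⟩ => ?_⟩
  exact varGroup_ext ht hs (htX.trans hsX.symm) ▸ hsI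

/-! ### Measuring sequences -/

/-- The properties of the measuring sequence of a family of monomial ideals that determine the
structure of `G A`. -/
structure IsMeasuring (A : Fin n → Ideal (PS n K)) : Prop where
  isMonomial : ∀ i, IsMonomial (A i)
  X_mem : ∀ i, X i ∈ A i
  mem_G : ∀ i, ∀ g ∈ varGroup K i, g (X i) ∈ A i → g ∈ G A

section Measuring

variable {r : ℕ} {I : Fin r → Ideal (PS n K)} {i : Fin n} {v : Fin n →₀ ℕ}

theorem measuring_eq_span_image :
    measuring I i = Ideal.span ((fun g : Aut n K => g (X i)) '' ↑(G I ⊓ varGroup K i)) := by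
  refine congrArg Ideal.span (Set.ext fun f => exists_congr fun g => ?_)
  rw [SetLike.mem_coe, Subgroup.mem_inf, mem_varGroup, ← and_assoc, and_comm (a := g ∈ G I)]
  exact Iff.rfl

theorem apply_X_mem_measuring {g : Aut n K} (hg : g ∈ G I ⊓ varGroup K i) :
    g (X i) ∈ measuring I i :=
  measuring_eq_span_image.ge (Ideal.subset_span ⟨g, hg, rfl⟩)

theorem X_mem_measuring (I : Fin r → Ideal (PS n K)) (i : Fin n) : X i ∈ measuring I i :=
  apply_X_mem_measuring (one_mem _)

theorem fixes_measuring {t : Aut n K}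
    (ht : ∀ g ∈ G I ⊓ varGroup K i, t (g (X i)) ∈ measuring I i) : Fixes t (measuring I i) := by
  refine fixes_of_forall_mem ?_
  suffices measuring I i ≤ (measuring I i).comap (t : PS n K →+* PS n K) from this
  conv_lhs => rw [measuring_eq_span_image]
  rw [Ideal.span_le]
  rintro _ ⟨g, hg, rfl⟩
  exact ht g hg

theorem measuring_eq_span_mono (hI : ∀ k, IsMonomial (I k)) : measuring I i =
    Ideal.span (mono K '' insert (Finsupp.single i 1) {v | mono K v ∈ transvections (G I) i}) := by
  apply le_antisymm
  · rw [measuring_eq_span_image, Ideal.span_le]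
    rintro _ ⟨g, ⟨hgI, hg⟩, rfl⟩
    refine mem_span_mono.2 fun v hv => ?_
    by_cases hi : v i = 0
    · refine ⟨v, Or.inr ?_, le_rfl⟩
      exact (mem_transvections_iff_mono hI).1 ((mem_G_iff_restrict_mem_transvections hI hg).1 hgI) v
        (coeff_restrict_ne_zero_iff.2 ⟨hi, hv⟩)
    · exact ⟨_, Or.inl rfl, by rwa [Finsupp.single_le_iff, Nat.one_le_iff_ne_zero]⟩
  · rw [Ideal.span_le]
    rintro _ ⟨v, rfl | ⟨-, g, hg, hgX⟩, rfl⟩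
    · exact X_mem_measuring I i
    · exact (Ideal.add_mem_iff_right _ (X_mem_measuring I i)).1 (hgX ▸ apply_X_mem_measuring hg)

theorem isMonomial_measuring (hI : ∀ k, IsMonomial (I k)) : IsMonomial (measuring I i) :=
  ⟨_, measuring_eq_span_mono hI⟩

theorem mono_mem_measuring_iff (hI : ∀ k, IsMonomial (I k)) (hi : v i = 0) :
    mono K v ∈ measuring I i ↔ mono K v ∈ transvections (G I) i := by
  rw [measuring_eq_span_mono hI, mono_mem_span_mono]
  refine ⟨?_, fun hv => ⟨v, Or.inr hv, le_rfl⟩⟩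
  rintro ⟨u, rfl | hu, huv⟩
  · rw [Finsupp.single_le_iff, hi] at huv
    omega
  · exact mono_mem_transvections_of_le hI hu huv hi

theorem fixes_measuring_self {t : Aut n K} (ht : t ∈ G I ⊓ varGroup K i) :
    Fixes t (measuring I i) :=
  fixes_measuring fun _ hg => apply_X_mem_measuring (mul_mem ht hg)

-- If `h` involves neither `x_i` nor `x_j`, then conjugation by `t` preserves the automorphisms that
-- move `x_j` only.
theorem fixes_measuring_of_mem_freeSubalgebra {t : Aut n K} (htI : t ∈ G I)
    (ht : t ∈ varGroup K i) {h : PS n K} (htX : t (X i) = X i + h) (hh : h ∈ freeSubalgebra K i)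
    {j : Fin n} (hj : j ≠ i) (hhj : h ∈ freeSubalgebra K j) : Fixes t (measuring I j) := by
  refine fixes_measuring fun g hg => ?_
  have hX {l : Fin n} (hl : l ≠ j) : X l ∈ freeSubalgebra K j :=
    mono_mem_freeSubalgebra.2 (Finsupp.single_eq_of_ne hl.symm)
  have h_inv {l : Fin n} (hl : l ≠ j) : t⁻¹ (X l) ∈ freeSubalgebra K j := by
    by_cases hli : l = i
    · rw [hli, inv_apply_X ht hh htX, ← hli]
      exact sub_mem (hX hl) hhj
    · rw [mem_varGroup.1 (inv_mem ht) l hli]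
      exact hX hl
  have h_conj : t * g * t⁻¹ ∈ varGroup K j := mem_varGroup.2 fun l hl => by
    rw [AlgEquiv.mul_apply, AlgEquiv.mul_apply,
      apply_eq_self_of_mem_freeSubalgebra hg.2 (h_inv hl)]
    exact t.apply_symm_apply _
  have h_apply : (t * g * t⁻¹) (X j) = t (g (X j)) := by
    rw [AlgEquiv.mul_apply, mem_varGroup.1 (inv_mem ht) j hj, AlgEquiv.mul_apply]
  have h_mem : t * g * t⁻¹ ∈ G I := mul_mem (mul_mem htI hg.1) (inv_mem htI)
  exact h_apply ▸ apply_X_mem_measuring ⟨h_mem, h_conj⟩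

theorem mono_mem_transvections_measuring (hI : ∀ k, IsMonomial (I k))
    (hv : mono K v ∈ transvections (G I) i) :
    mono K v ∈ transvections (G (measuring I)) i := by
  obtain ⟨hfree, t, ⟨htI, ht⟩, htX⟩ := hv
  refine ⟨hfree, t, ⟨fun j => ?_, ht⟩, htX⟩
  obtain rfl | hj := eq_or_ne j i
  · exact fixes_measuring_self ⟨htI, ht⟩
  by_cases hvj : v j = 0
  · exact fixes_measuring_of_mem_freeSubalgebra htI ht htX hfree hj
      (mono_mem_freeSubalgebra.2 hvj)
  · refine fixes_of_X_sub_mem (isMonomial_measuring hI) fun l => ?_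
    by_cases hl : l = i
    · rw [hl, htX, add_sub_cancel_left]
      refine mono_mem_of_le (u := Finsupp.single j 1) ?_ (X_mem_measuring I j)
      rwa [Finsupp.single_le_iff, Nat.one_le_iff_ne_zero]
    · rw [mem_varGroup.1 ht l hl, sub_self]
      exact zero_mem _

theorem isMeasuring_measuring (hI : ∀ k, IsMonomial (I k)) : IsMeasuring (measuring I) where
  isMonomial _ := isMonomial_measuring hI
  X_mem := X_mem_measuring I
  mem_G i g hg hgX := by
    have hA (j : Fin n) : IsMonomial (measuring I j) := isMonomial_measuring hI
    rw [mem_G_iff_restrict_mem_transvections hA hg, mem_transvections_iff_mono hA]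
    intro v hv
    obtain ⟨hi, hv⟩ := coeff_restrict_ne_zero_iff.1 hv
    exact mono_mem_transvections_measuring hI
      ((mono_mem_measuring_iff hI hi).1 ((hA i).mem_iff.1 hgX v hv))

theorem finite_setOf_mono_notMem {J : Ideal (PS n K)} [FiniteDimensional K (PS n K ⧸ J)] :
    {v : Fin n →₀ ℕ | mono K v ∉ J}.Finite := by
  have : IsArtinianRing (PS n K ⧸ J) := IsArtinianRing.of_finite K _
  obtain ⟨N, hN⟩ := IsLocalRing.exists_maximalIdeal_pow_le_of_isArtinianRing_quotient J
  refine (Finsupp.finite_of_degree_lt N).subset fun v hv => ?_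
  by_contra hlt
  refine hv (hN (mem_maximalIdeal_pow.2 fun u hu => ?_))
  exact eq_of_coeff_mono_ne_zero hu ▸ not_lt.1 hlt

theorem finite_setOf_mono_notMem_measuring (hI : ∀ k, IsMonomial (I k))
    (hfin : ∀ k, {v : Fin n →₀ ℕ | mono K v ∉ I k}.Finite) (i : Fin n) :
    {v : Fin n →₀ ℕ | mono K v ∉ measuring I i}.Finite := by
  refine ((Set.finite_iUnion hfin).insert 0).subset fun v hv => ?_
  by_contra hv'
  simp only [Set.mem_insert_iff, Set.mem_iUnion, Set.mem_ofPred_eq, not_or, not_exists,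
    not_not] at hv'
  refine hv ?_
  by_cases hi : v i = 0
  · rw [mono_mem_measuring_iff hI hi, mono_mem_transvections_iff hI]
    exact ⟨hi, hv'.1, admissible_of_forall_mono_mem hv'.2⟩
  · refine mono_mem_of_le (u := Finsupp.single i 1) ?_ (X_mem_measuring I i)
    rwa [Finsupp.single_le_iff, Nat.one_le_iff_ne_zero]

end Measuring

/-! ### Linear parts -/

section BlockDiagonal

variable {ι α : Type*} [Fintype ι] [DecidableEq ι] {M : Matrix ι ι K} {b : ι → α}
  {S : Submonoid (Matrix ι ι K)}

open Matrix

-- Every invertible matrix is a product of transvections and an invertible diagonal matrix.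
theorem reindex_fromBlocks_mem (p : ι → Prop) [DecidablePred p]
    (h_diag : ∀ d : ι → K, (∀ i, d i ≠ 0) → diagonal d ∈ S)
    (h_trans : ∀ i j, i ≠ j → p i → p j → ∀ c, transvection i j c ∈ S)
    {N : Matrix {i // p i} {i // p i} K} (hN : N.det ≠ 0) :
    reindexAlgEquiv K K (Equiv.sumCompl p) (fromBlocks N 0 0 1) ∈ S := by
  refine diagonal_transvection_induction_of_det_ne_zero
    (fun N => reindexAlgEquiv K K (Equiv.sumCompl p) (fromBlocks N 0 0 1) ∈ S) N hN
    (fun d hd => ?_) (fun t => ?_) fun N N' _ _ h h' => ?_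
  · rw [det_diagonal, Finset.prod_ne_zero_iff] at hd
    rw [← diagonal_one, fromBlocks_diagonal, coe_reindexAlgEquiv, reindex_apply,
      submatrix_diagonal_equiv]
    refine h_diag _ fun i => ?_
    obtain ⟨x, rfl⟩ := (Equiv.sumCompl p).surjective i
    rw [Function.comp_apply, Equiv.symm_apply_apply]
    cases x with
    | inl x => exact hd x (Finset.mem_univ x)
    | inr _ => exact one_ne_zero
  · rw [← TransvectionStruct.toMatrix_sumInl, ← TransvectionStruct.toMatrix_reindexEquiv]
    exact h_trans _ _ (TransvectionStruct.hij _) t.i.2 t.j.2 _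
  · have h_mul := mul_mem h h'
    simpa only [← map_mul, fromBlocks_multiply, Matrix.mul_zero, Matrix.zero_mul, Matrix.mul_one,
      add_zero, zero_add] using h_mul

theorem of_ite_mem {k : α} [DecidablePred (b · = k)]
    (h_diag : ∀ d : ι → K, (∀ i, d i ≠ 0) → diagonal d ∈ S)
    (h_trans : ∀ i j, i ≠ j → b i = b j → ∀ c, transvection i j c ∈ S)
    (hM : ∀ i j, b i ≠ b j → M i j = 0) (h_det : M.det ≠ 0) :
    (of fun i => if b i = k then M i else (1 : Matrix ι ι K) i) ∈ S := by
  have h_unit : (M.toSquareBlockProp (b · = k)).det ≠ 0 := by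
    rw [twoBlockTriangular_det M (b · = k) fun i hi j hj => hM i j fun h => hi (h.trans hj)]
      at h_det
    exact left_ne_zero_of_mul h_det
  convert reindex_fromBlocks_mem (b · = k) h_diag
    (fun i j hij hi hj => h_trans i j hij (hi.trans hj.symm)) h_unit
  ext i j
  obtain ⟨i | i, rfl⟩ := (Equiv.sumCompl (b · = k)).surjective i <;>
    obtain ⟨j | j, rfl⟩ := (Equiv.sumCompl (b · = k)).surjective j
  · simp [toSquareBlockProp, i.2]
  · simpa [i.2] using hM i j fun h => j.2 (h ▸ i.2)
  · have hij : (i : ι) ≠ j := fun h => i.2 (by rw [h, j.2])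
    simp [i.2, hij]
  · simp [i.2, one_apply, Subtype.ext_iff]

theorem mem_of_blockDiagonal
    (h_diag : ∀ d : ι → K, (∀ i, d i ≠ 0) → diagonal d ∈ S)
    (h_trans : ∀ i j, i ≠ j → b i = b j → ∀ c, transvection i j c ∈ S)
    (hM : ∀ i j, b i ≠ b j → M i j = 0) (h_det : M.det ≠ 0) : M ∈ S := by
  classical
  let rows (s : Finset α) : Matrix ι ι K :=
    of fun i => if b i ∈ s then M i else (1 : Matrix ι ι K) i
  have h_insert {k : α} {s : Finset α} (hk : k ∉ s) :
      (of fun i => if b i = k then M i else (1 : Matrix ι ι K) i) * rows s = rows (insert k s) := by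
    ext i j
    by_cases hi : b i = k
    · trans (M * 1 : Matrix ι ι K) i j
      · refine Finset.sum_congr rfl fun l _ => ?_
        by_cases hl : b i = b l
        · simp [rows, ← hl, hi, hk]
        · simp [hi, hM i l hl]
      · simp [rows, hi]
    · trans ((1 : Matrix ι ι K) * rows s) i j
      · refine Finset.sum_congr rfl fun l _ => ?_
        simp [hi]
      · simp [rows, hi]
  suffices ∀ s : Finset α, rows s ∈ S by
    convert this (Finset.univ.image b)
    ext i
    simp [rows]
  intro s
  induction s using Finset.induction_on with
  | empty => exact one_mem S
  | insert k s hk ih => exact h_insert hk ▸ mul_mem (of_ite_mem h_diag h_trans hM h_det) ih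

end BlockDiagonal

section LinearPart

variable {w : Fin n → ℕ} {J : Ideal (PS n K)} {g : Aut n K} {i j : Fin n}

theorem sub_sum_coeff_smul_X_mem (f : PS n K) : f - algebraMap K _ (constantCoeff f) -
    ∑ j, coeff (Finsupp.single j 1) f • X j ∈ maximalIdeal (PS n K) ^ 2 := by
  refine mem_maximalIdeal_pow.2 fun v hv => not_lt.1 fun hlt => hv ?_
  obtain rfl | ⟨l, rfl⟩ := eq_zero_or_single_of_degree_lt_two hlt
  · simp [MvPowerSeries.algebraMap_apply]
  · simp [MvPowerSeries.algebraMap_apply, coeff_C, coeff_X, Finsupp.single_left_inj]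

theorem coeff_single_apply (g : Aut n K) (f : PS n K) (l : Fin n) :
    coeff (Finsupp.single l 1) (g f) =
      ∑ j, coeff (Finsupp.single l 1) (g (X j)) * coeff (Finsupp.single j 1) f := by
  have h := mem_maximalIdeal_pow.1 (algHom_mem_maximalIdeal_pow g (sub_sum_coeff_smul_X_mem f))
    (Finsupp.single l 1)
  rw [Finsupp.degree_single] at h
  have h_zero := not_imp_comm.1 h (by norm_num)
  simp only [map_sub, AlgEquiv.commutes, map_sum] at h_zero
  rw [sub_sub, sub_eq_zero] at h_zero
  rw [h_zero]
  simp [MvPowerSeries.algebraMap_apply, coeff_C, mul_comm]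

/-- The matrix of the map induced by `g` on the cotangent space of `K[[x_1, …, x_n]]`: its `i`-th
column holds the linear coefficients of `g (x_i)`. -/
noncomputable def linearPart : Aut n K →* Matrix (Fin n) (Fin n) K where
  toFun g := Matrix.of fun j i => coeff (Finsupp.single j 1) (g (X i))
  map_one' := Matrix.ext fun j i => by
    simp [coeff_X, Finsupp.single_left_inj, Matrix.one_apply]
  map_mul' g h := Matrix.ext fun j i => coeff_single_apply g (h (X i)) j

theorem linearPart_apply : linearPart g j i = coeff (Finsupp.single j 1) (g (X i)) := rfl

theorem det_linearPart_ne_zero (g : Aut n K) : (linearPart g).det ≠ 0 :=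
  (((Group.isUnit g).map linearPart).map Matrix.detMonoidHom).ne_zero

theorem Fixes.X_mem (hg : Fixes g J) (hJ : IsMonomial J) (hi : X i ∈ J)
    (hji : linearPart g j i ≠ 0) : X j ∈ J :=
  hJ.mem_iff.1 (hg.map_mem hi) _ hji

theorem fixes_of_linearPart (hJ : IsMonomial J) (h_sq : maximalIdeal (PS n K) ^ 2 ≤ J)
    (h : ∀ i j, X i ∈ J → linearPart g j i ≠ 0 → X j ∈ J) : Fixes g J := by
  by_cases h_one : (1 : PS n K) ∈ J
  · rw [(Ideal.eq_top_iff_one J).2 h_one]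
    exact fixes_of_forall_mem fun _ _ => Submodule.mem_top
  refine fixes_of_forall_mem fun f hf => hJ.map_mem (g : PS n K →+* PS n K) (fun v hv => ?_) hf
  change g (mono K v) ∈ J
  by_cases hdeg : 2 ≤ v.degree
  · refine h_sq (algHom_mem_maximalIdeal_pow g (mem_maximalIdeal_pow.2 fun u hu => ?_))
    exact eq_of_coeff_mono_ne_zero hu ▸ hdeg
  obtain rfl | ⟨i, rfl⟩ := eq_zero_or_single_of_degree_lt_two (not_le.1 hdeg)
  · exact absurd hv h_one
  rw [mono_single_one] at hv ⊢
  rw [← sub_add_cancel (g (X i)) (∑ j, linearPart g j i • X j)]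
  refine add_mem (h_sq ?_) (sum_mem fun j _ => ?_)
  · simpa [constantCoeff_algHom, linearPart_apply] using sub_sum_coeff_smul_X_mem (g (X i))
  · by_cases hji : linearPart g j i = 0
    · rw [hji, zero_smul]
      exact zero_mem J
    · exact Submodule.smul_of_tower_mem J _ (h i j hv hji)

theorem mem_unipotent_iff_linearPart (hw : ∀ i j, w i < 2 * w j) :
    g ∈ unipotent K w ↔ ∀ i j, w j ≤ w i → linearPart g j i = (1 : Matrix _ _ K) j i := by
  have h_coeff (i j : Fin n) : coeff (Finsupp.single j 1) (g (X i) - X i) ≠ 0 ↔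
      linearPart g j i ≠ (1 : Matrix _ _ K) j i := by
    rw [← map_one linearPart, map_sub, sub_ne_zero]
    exact Iff.rfl
  refine ⟨fun hg i j hji => ?_, fun h i => mem_weightIdeal.2 fun v hv => ?_⟩
  · by_contra hne
    have h_weight := mem_weightIdeal.1 (hg i) _ ((h_coeff i j).2 hne)
    rw [Finsupp.weight_single, one_smul] at h_weight
    omega
  obtain hdeg | hdeg := lt_or_ge v.degree 2
  · obtain rfl | ⟨j, rfl⟩ := eq_zero_or_single_of_degree_lt_two hdeg
    · simp [constantCoeff_algHom] at hv
    · rw [Finsupp.weight_single, one_smul]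
      exact not_le.1 fun hji => (h_coeff i j).1 hv (h i j hji)
  · have h_le : v.degree * (w i + 1) ≤ 2 * Finsupp.weight w v := by
      rw [Finsupp.degree_apply, Finsupp.weight_apply, Finsupp.sum, Finset.sum_mul, Finset.mul_sum]
      refine Finset.sum_le_sum fun j _ => ?_
      rw [smul_eq_mul, mul_left_comm]
      exact Nat.mul_le_mul_left _ (hw i j)
    nlinarith

end LinearPart

/-! ### Chains -/

section Chains

variable {A : Fin n → Ideal (PS n K)} {m : ℕ} {B : Fin (m + 1) → Ideal (PS n K)}
  {J J' : Ideal (PS n K)} {S : Set (Fin n)} {h : PS n K} {i j : Fin n}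

theorem IsMeasuring.exists_mem_G_add (hA : IsMeasuring A) (h_free : h ∈ freeSubalgebra K i)
    (h_const : constantCoeff h = 0) (h_mem : h ∈ A i) :
    ∃ g ∈ G A ⊓ varGroup K i, g (X i) = X i + h := by
  obtain ⟨g, hg, hgX⟩ := exists_mem_varGroup_add h_free h_const
  exact ⟨g, ⟨hA.mem_G i g hg (hgX ▸ add_mem (hA.X_mem i) h_mem), hg⟩, hgX⟩

theorem IsMeasuring.exists_mem_G_add_smul_X (hA : IsMeasuring A) (hij : i ≠ j)
    (h_mem : X j ∈ A i) (c : K) : ∃ g ∈ G A ⊓ varGroup K i, g (X i) = X i + c • X j :=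
  hA.exists_mem_G_add (Subalgebra.smul_mem _
    (mono_single_one (K := K) j ▸ mono_mem_freeSubalgebra.2 (Finsupp.single_eq_of_ne hij)) c)
    (by simp) (Submodule.smul_of_tower_mem _ c h_mem)

theorem IsMeasuring.X_mem_trans (hA : IsMeasuring A) {l : Fin n} (hj : X j ∈ A l)
    (hl : X l ∈ A i) : X j ∈ A i := by
  obtain rfl | hne := eq_or_ne l j
  · exact hl
  obtain ⟨g, hg, hgX⟩ := hA.exists_mem_G_add_smul_X hne hj 1
  have h_image := (hg.1 i).map_mem hl
  rw [hgX, one_smul] at h_image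
  exact (add_mem_cancel_left hl).1 h_image

theorem le_of_forall_X_mem (hJ : J ≤ maximalIdeal (PS n K)) (h_mon : IsMonomial J)
    (h_sq : maximalIdeal (PS n K) ^ 2 ≤ J') (h : ∀ i, X i ∈ J → X i ∈ J') :
    J ≤ J' := by
  intro f hf
  rw [← sub_add_cancel f (∑ j, coeff (Finsupp.single j 1) f • X j)]
  refine add_mem (h_sq ?_) (sum_mem fun j _ => ?_)
  · simpa [mem_maximalIdeal.1 (hJ hf)] using sub_sum_coeff_smul_X_mem f
  · by_cases hj : coeff (Finsupp.single j 1) f = 0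
    · simp [hj]
    · exact Submodule.smul_of_tower_mem J' _ (h j (h_mon.mem_iff.1 hf _ hj))

open Classical in
/-- The ideal `𝔪² + (x_i, i ∈ S)`, given by weights so that it is visibly monomial. -/
noncomputable def varIdeal (K : Type*) [Field K] (S : Set (Fin n)) : Ideal (PS n K) :=
  weightIdeal (fun i => if i ∈ S then 2 else 1) 2

theorem isMonomial_varIdeal (S : Set (Fin n)) : IsMonomial (varIdeal K S) :=
  isMonomial_weightIdeal

theorem X_mem_varIdeal : X i ∈ varIdeal K S ↔ i ∈ S := by
  classical
  rw [← mono_single_one, varIdeal, mono_mem_weightIdeal, Finsupp.weight_single, one_smul]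
  split_ifs with hi <;> simp [hi]

theorem sq_le_varIdeal (S : Set (Fin n)) :
    maximalIdeal (PS n K) ^ 2 ≤ varIdeal K S := by
  classical
  refine fun f hf => mem_weightIdeal.2 fun v hv => (mem_maximalIdeal_pow.1 hf v hv).trans ?_
  rw [Finsupp.degree_apply, Finsupp.weight_apply]
  refine Finset.sum_le_sum fun i _ => Nat.le_mul_of_pos_right _ ?_
  split_ifs <;> simp

theorem varIdeal_le_maximalIdeal (S : Set (Fin n)) :
    varIdeal K S ≤ maximalIdeal (PS n K) := fun _ hf =>
  mem_maximalIdeal.2 (constantCoeff_of_mem_weightIdeal two_pos hf)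

theorem X_notMem_maximalIdeal_sq (i : Fin n) :
    (X i : PS n K) ∉ maximalIdeal (PS n K) ^ 2 := by
  rw [← mono_single_one, maximalIdeal_pow, mono_mem_weightIdeal]
  simp [Finsupp.weight_single]

/-- The index of the first ideal of `B` that contains `x_i`. -/
noncomputable def level (B : Fin (m + 1) → Ideal (PS n K)) (i : Fin n) : Fin (m + 1) :=
  sInf {k | X i ∈ B k}

theorem IsChain.X_mem_iff (hB : IsChain A B) {k : Fin (m + 1)} : X i ∈ B k ↔ level B i ≤ k := by
  have h_last : X i ∈ B (Fin.last m) := by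
    rw [hB.last_eq, mem_maximalIdeal, constantCoeff_X]
  have h_level : X i ∈ B (level B i) := csInf_mem (s := {k | X i ∈ B k}) ⟨Fin.last m, h_last⟩
  exact ⟨fun h => csInf_le' h, fun h => hB.strictMono.monotone h h_level⟩

theorem IsChain.le_maximalIdeal (hB : IsChain A B) (k : Fin (m + 1)) :
    B k ≤ maximalIdeal (PS n K) :=
  hB.last_eq ▸ hB.strictMono.monotone (Fin.le_last k)

theorem IsChain.sq_lt_apply (hB : IsChain A B) (k : Fin (m + 1)) :
    maximalIdeal (PS n K) ^ 2 < B k :=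
  hB.sq_lt.trans_le (hB.strictMono.monotone (Fin.zero_le k))

theorem IsChain.varLT_iff (hB : IsChain A B) : VarLT B i j ↔ level B i < level B j := by
  have h_le (i j : Fin n) : VarLE B i j ↔ level B i ≤ level B j := by
    simp only [VarLE, hB.X_mem_iff]
    exact forall_ge_iff_le
  rw [VarLT, h_le, h_le, lt_iff_le_not_ge]

theorem IsChain.mem_G_iff (hB : IsChain A B) {f : Aut n K} :
    f ∈ G B ↔ ∀ i j, linearPart f j i ≠ 0 → level B j ≤ level B i := by
  refine ⟨fun hf i j hji => hB.X_mem_iff.1 ?_, fun h k => ?_⟩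
  · exact (hf (level B i)).X_mem (hB.isMonomial _) (hB.X_mem_iff.2 le_rfl) hji
  · refine fixes_of_linearPart (hB.isMonomial k) (hB.sq_lt_apply k).le fun i j hi hji => ?_
    exact hB.X_mem_iff.2 ((h i j hji).trans (hB.X_mem_iff.1 hi))

theorem IsChain.insertNth (hB : IsChain A B) {p : Fin (m + 1)} (hJ : IsMonomial J)
    (h_sq : maximalIdeal (PS n K) ^ 2 < J) (h_fixes : ∀ g ∈ G A, Fixes g J)
    (h_below : ∀ k < p, B k < J) (h_above : ∀ k, p ≤ k → J < B k) :
    IsChain A (p.castSucc.insertNth J B : Fin (m + 1 + 1) → Ideal (PS n K)) where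
  isMonomial := (Fin.forall_iff_succAbove p.castSucc).2
    ⟨by simpa using hJ, fun k => by simpa using hB.isMonomial k⟩
  sq_lt := by
    suffices ∀ k, maximalIdeal (PS n K) ^ 2 <
      (p.castSucc.insertNth J B : Fin (m + 1 + 1) → Ideal (PS n K)) k from this 0
    exact (Fin.forall_iff_succAbove p.castSucc).2
      ⟨by simpa using h_sq, fun k => by simpa using hB.sq_lt_apply k⟩
  strictMono := (Fin.strictMono_insertNth_iff _ _ _).2
    ⟨hB.strictMono, fun k hk => h_below k (Fin.castSucc_lt_castSucc_iff.1 hk),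
      fun k hk => h_above k (Fin.castSucc_le_castSucc_iff.1 hk)⟩
  last_eq := by
    rw [← Fin.succAbove_ne_last_last (Fin.castSucc_lt_last p).ne, Fin.insertNth_apply_succAbove,
      hB.last_eq]
  le g hg := (Fin.forall_iff_succAbove p.castSucc).2
    ⟨by simpa using h_fixes g hg, fun k => by simpa using hB.le hg k⟩

-- Otherwise the ideal generated by `𝔪²`, the variables below `x_i` and those of the level of `x_i`
-- that lie in `A i` could be inserted into the chain.
theorem IsMaxChain.X_mem_of_level_eq (hB : IsMaxChain A B) (hA : IsMeasuring A)
    (hij : level B i = level B j) : X j ∈ A i := by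
  have hC := hB.toIsChain
  by_contra hj
  set S : Set (Fin n) := {l | level B l < level B i ∨ level B l = level B i ∧ X l ∈ A i} with hS
  have hi : i ∈ S := Or.inr ⟨rfl, hA.X_mem i⟩
  have hj : j ∉ S := by simp [hS, hij, hj]
  have h_fixes (g : Aut n K) (hg : g ∈ G A) : Fixes g (varIdeal K S) := by
    refine fixes_of_linearPart (isMonomial_varIdeal S) (sq_le_varIdeal S) fun l p hl hpl => ?_
    rw [X_mem_varIdeal] at hl ⊢
    have h_level : level B p ≤ level B l := hC.mem_G_iff.1 (hC.le hg) l p hpl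
    have h_mem : X p ∈ A l := (hg l).X_mem (hA.isMonomial l) (hA.X_mem l) hpl
    obtain hl | ⟨hl, hlA⟩ := hl
    · exact Or.inl (h_level.trans_lt hl)
    · exact (hl ▸ h_level).lt_or_eq.imp_right fun h => ⟨h, hA.X_mem_trans h_mem hlA⟩
  have h_below (k : Fin (m + 1)) (hk : k < level B i) : B k < varIdeal K S := by
    refine lt_of_le_of_ne (le_of_forall_X_mem (hC.le_maximalIdeal k) (hC.isMonomial k)
      (sq_le_varIdeal S) fun l hl => X_mem_varIdeal.2 (Or.inl ?_)) fun h => ?_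
    · exact (hC.X_mem_iff.1 hl).trans_lt hk
    · exact hk.not_ge (hC.X_mem_iff.1 (h ▸ X_mem_varIdeal.2 hi))
  have h_above (k : Fin (m + 1)) (hk : level B i ≤ k) : varIdeal K S < B k := by
    refine lt_of_le_of_ne (le_of_forall_X_mem (varIdeal_le_maximalIdeal S) (isMonomial_varIdeal S)
      (hC.sq_lt_apply k).le fun l hl => hC.X_mem_iff.2 (le_trans ?_ hk)) fun h => ?_
    · exact (X_mem_varIdeal.1 hl).elim le_of_lt fun h => h.1.le
    · exact hj (X_mem_varIdeal.1 (h ▸ hC.X_mem_iff.2 (hij ▸ hk)))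
  have h_sq : maximalIdeal (PS n K) ^ 2 < varIdeal K S :=
    lt_of_le_of_ne (sq_le_varIdeal S) fun h =>
      X_notMem_maximalIdeal_sq i (h ▸ X_mem_varIdeal.2 hi)
  exact absurd (hB.maximal (m + 1) _
    (hC.insertNth (isMonomial_varIdeal S) h_sq h_fixes h_below h_above)) (by simp)

/-- Weights that strictly decrease along the levels of `B`. Any two of them differ by a factor less
than `2`, so that monomials of degree at least `2` weigh more than each variable. -/
noncomputable def varWeight (B : Fin (m + 1) → Ideal (PS n K)) (i : Fin n) : ℕ :=
  m + 1 + (level B i).rev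

theorem varWeight_lt_two_mul (B : Fin (m + 1) → Ideal (PS n K)) (i j : Fin n) :
    varWeight B i < 2 * varWeight B j := by
  have := (level B i).rev.is_le
  unfold varWeight
  omega

theorem varWeight_le_varWeight : varWeight B i ≤ varWeight B j ↔ level B j ≤ level B i := by
  rw [varWeight, varWeight, add_le_add_iff_left, Fin.val_fin_le, Fin.rev_le_rev]

theorem mem_unipotent_varWeight_iff {g : Aut n K} : g ∈ unipotent K (varWeight B) ↔
    ∀ i j, level B i ≤ level B j → linearPart g j i = (1 : Matrix _ _ K) j i := by
  simp only [mem_unipotent_iff_linearPart (varWeight_lt_two_mul B), varWeight_le_varWeight]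

theorem IsChain.unipotent_le (hB : IsChain A B) : unipotent K (varWeight B) ≤ G B := by
  refine fun g hg => hB.mem_G_iff.2 fun i j hji => le_of_not_gt fun hlt => hji ?_
  rw [mem_unipotent_varWeight_iff.1 hg i j hlt.le, Matrix.one_apply_ne (by rintro rfl; simp at hlt)]

end Chains

/-! ### Representatives -/

section Representatives

variable {A : Fin n → Ideal (PS n K)} {m : ℕ} {B : Fin (m + 1) → Ideal (PS n K)}
  {w : Fin n → ℕ} {g : Aut n K}

theorem IsMeasuring.exists_mem_G_apply_X_eq (hA : IsMeasuring A) (hg : g ∈ unipotent K w)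
    {i : Fin n} (h : g (X i) - X i ∈ A i) :
    ∃ t ∈ G A ⊓ varGroup K i, t ∈ unipotent K w ∧ t (X i) = g (X i) := by
  have h_lin : coeff (Finsupp.single i 1) (g (X i)) = 1 := by
    have h_weight := mt (mem_weightIdeal.1 (hg i) (Finsupp.single i 1))
      (by simp [Finsupp.weight_single])
    simpa [sub_eq_zero] using h_weight
  obtain ⟨t, ht, htX⟩ := exists_mem_varGroup (i := i) (f := g (X i))
    (by simp [constantCoeff_algHom]) (by simp [h_lin])
  refine ⟨t, ⟨hA.mem_G i t ht ?_, ht⟩, mem_unipotent.2 fun j => ?_, htX⟩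
  · exact htX ▸ (Submodule.sub_mem_iff_left _ (hA.X_mem i)).1 h
  · obtain rfl | hj := eq_or_ne j i
    · exact htX ▸ hg j
    · simp [mem_varGroup.1 ht j hj]

-- Split off automorphisms that move a single variable, one at a time.
theorem IsMeasuring.mem_G_of_mem_unipotent (hA : IsMeasuring A) (hg : g ∈ unipotent K w)
    (h : ∀ i, g (X i) - X i ∈ A i) : g ∈ G A := by
  have h_fix : ∀ i ∉ (Finset.univ : Finset (Fin n)), g (X i) = X i := by simp
  generalize (Finset.univ : Finset (Fin n)) = s at h_fix
  induction s using Finset.induction_on generalizing g with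
  | empty =>
    rw [show g = 1 from algHom_ext_X fun i => h_fix i (Finset.notMem_empty i)]
    exact one_mem _
  | insert i s _ ih =>
    obtain ⟨t, ⟨htA, ht⟩, htw, htX⟩ := hA.exists_mem_G_apply_X_eq hg (h i)
    have h_self : (t⁻¹ * g) (X i) = X i := by
      rw [AlgEquiv.mul_apply, ← htX]
      exact t.symm_apply_apply _
    have h_ne {j : Fin n} (hj : j ≠ i) : t⁻¹ (X j) = X j := mem_varGroup.1 (inv_mem ht) j hj
    have h_mem : t⁻¹ * g ∈ G A := by
      refine ih (mul_mem (inv_mem htw) hg) (fun j => ?_) fun j hj => ?_ <;>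
        obtain rfl | hji := eq_or_ne j i
      · simp [h_self]
      · have h_image := ((G A).inv_mem htA j).map_mem (h j)
        rwa [map_sub, h_ne hji] at h_image
      · exact h_self
      · rw [AlgEquiv.mul_apply, h_fix j (by simp [hji, hj]), h_ne hji]
    simpa using mul_mem htA h_mem

theorem IsMaxChain.exists_mem_G_linearPart_eq (hB : IsMaxChain A B) (hA : IsMeasuring A)
    {D : Matrix (Fin n) (Fin n) K} (hD : ∀ i j, level B i ≠ level B j → D i j = 0)
    (h_det : D.det ≠ 0) : ∃ p ∈ G A, linearPart p = D := by
  refine mem_of_blockDiagonal (S := (G A).toSubmonoid.map linearPart) (b := level B)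
    (fun d hd => ?_) (fun i j hij h_level c => ?_) hD h_det
  · obtain ⟨g, hg⟩ := exists_apply_X_eq_smul hd
    refine ⟨g, fun i => fixes_of_dvd (hA.isMonomial i) fun j => ?_, Matrix.ext fun j i => ?_⟩
    · exact ⟨C (d j), by rw [hg, smul_eq_C_mul, mul_comm]⟩
    · obtain rfl | hij := eq_or_ne j i
      · simp [linearPart_apply, hg]
      · simp [linearPart_apply, hg, coeff_X, Finsupp.single_left_inj, hij]
  · obtain ⟨g, hg, hgX⟩ :=
      hA.exists_mem_G_add_smul_X hij.symm (hB.X_mem_of_level_eq hA h_level.symm) c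
    refine ⟨g, hg.1, Matrix.ext fun k l => ?_⟩
    obtain rfl | hl := eq_or_ne l j
    · simp [linearPart_apply, hgX, coeff_X, Finsupp.single_left_inj, Matrix.transvection,
        Matrix.one_apply, Matrix.single_apply, eq_comm]
    · simp [linearPart_apply, mem_varGroup.1 hg.2 l hl, coeff_X, Finsupp.single_left_inj,
        Matrix.transvection, Matrix.one_apply, hl.symm]

theorem IsMaxChain.exists_eq_mul (hB : IsMaxChain A B) (hA : IsMeasuring A) {f : Aut n K}
    (hf : f ∈ G B) : ∃ u ∈ unipotent K (varWeight B), ∃ p ∈ G A, f = u * p := by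
  have hC := hB.toIsChain
  let D : Matrix (Fin n) (Fin n) K :=
    Matrix.of fun i j => if level B i = level B j then linearPart f i j else 0
  have h_tri {g : Aut n K} (hg : g ∈ G B) : (linearPart g).BlockTriangular (level B) :=
    fun j i hji => not_imp_comm.1 (hC.mem_G_iff.1 hg i j) hji.not_ge
  have hD : D.BlockTriangular (level B) := fun i j hij => by simp [D, hij.ne']
  have h_det : D.det = (linearPart f).det := by
    rw [hD.det, (h_tri hf).det]
    refine Finset.prod_congr rfl fun a _ => congrArg Matrix.det (Matrix.ext fun i j => ?_)
    simp [D, Matrix.toSquareBlock_def, i.2, j.2]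
  obtain ⟨p, hp, hpD⟩ := hB.exists_mem_G_linearPart_eq hA (D := D) (fun i j hij => by simp [D, hij])
    (h_det ▸ det_linearPart_ne_zero f)
  refine ⟨f * p⁻¹, mem_unipotent_varWeight_iff.2 fun i j hij => ?_, p, hp, by simp⟩
  have h_inv : D * linearPart p⁻¹ = 1 := by rw [← hpD, ← map_mul, mul_inv_cancel, map_one]
  rw [map_mul, ← h_inv, Matrix.mul_apply, Matrix.mul_apply]
  refine Finset.sum_congr rfl fun l _ => ?_
  obtain hlj | hlj := eq_or_ne (level B j) (level B l)
  · simp [D, hlj]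
  obtain hlt | hlt := hlj.lt_or_gt
  · simp [h_tri (hC.le (inv_mem hp)) (hij.trans_lt hlt)]
  · simp [D, hlj, h_tri hf hlt]

theorem mem_reps_iff (hfin : ∀ i, {v : Fin n →₀ ℕ | mono K v ∉ A i}.Finite) :
    g ∈ reps A B ↔ ∀ i v, coeff v (g (X i) - X i) ≠ 0 → (i, v) ∈ pairs A B := by
  have h_coeff (a : (Fin n →₀ ℕ) →₀ K) (v : Fin n →₀ ℕ) :
      coeff v (a.sum fun v c => c • mono K v) = a v := by
    classical
    simp [Finsupp.sum, mono, coeff_monomial, eq_comm]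
  constructor
  · rintro ⟨a, ha, hgX⟩ i v hv
    rw [hgX, add_sub_cancel_left, h_coeff] at hv
    exact ha i v (Finsupp.mem_support_iff.2 hv)
  · intro h
    have h_support (i : Fin n) : (Function.support fun v => coeff v (g (X i) - X i)).Finite :=
      (hfin i).subset fun v hv => (h i v hv).1
    refine ⟨fun i => Finsupp.ofSupportFinite _ (h_support i),
      fun i v hv => h i v (Finsupp.mem_support_iff.1 hv), fun i => ?_⟩
    refine sub_eq_iff_eq_add'.1 (MvPowerSeries.ext fun v => ?_)
    rw [h_coeff, Finsupp.ofSupportFinite_coe]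

theorem IsChain.mem_reps_iff_mem_unipotent (hB : IsChain A B)
    (hfin : ∀ i, {v : Fin n →₀ ℕ | mono K v ∉ A i}.Finite) :
    g ∈ reps A B ↔ g ∈ unipotent K (varWeight B) ∧
      ∀ i v, mono K v ∈ A i → coeff v (g (X i) - X i) = 0 := by
  have h_linear (i j : Fin n) : coeff (Finsupp.single j 1) (g (X i) - X i) = 0 ↔
      linearPart g j i = (1 : Matrix _ _ K) j i := by
    rw [← map_one linearPart, map_sub, sub_eq_zero]
    exact Iff.rfl
  rw [mem_reps_iff hfin, mem_unipotent_varWeight_iff]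
  refine ⟨fun h => ⟨fun i j hij => (h_linear i j).1 ?_, fun i v hv => ?_⟩, fun ⟨hg, h⟩ i v hv =>
    ⟨fun hvA => hv (h i v hvA), ?_⟩⟩
  · by_contra hne
    exact hij.not_gt (hB.varLT_iff.1 ((h i _ hne).2 j rfl))
  · by_contra hne
    exact (h i v hne).1 hv
  · rintro j rfl
    exact hB.varLT_iff.2 (not_le.1 fun hij => hv ((h_linear i j).2 (hg i j hij)))

theorem IsMeasuring.exists_mul_coeff_eq_zero (hA : IsMeasuring A) {u : Aut n K}
    (hu : u ∈ unipotent K w) : ∃ k ∈ G A, u * k ∈ unipotent K w ∧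
      ∀ i v, mono K v ∈ A i → coeff v ((u * k) (X i) - X i) = 0 := by
  choose b hb _ using fun i => existsUnique_coeff_apply_eq hu (hA.isMonomial i) (u (X i) - X i)
  have h_weight (i : Fin n) : b i ∈ weightIdeal w (w i + 1) :=
    mem_weightIdeal_of_coeff_apply_eq hu (hA.isMonomial i) (hb i).1 (hb i).2 (hu i)
  obtain ⟨k, hk, hkX⟩ := exists_mem_unipotent (a := fun i => X i - b i) fun i => by
    simpa using h_weight i
  refine ⟨k, hA.mem_G_of_mem_unipotent hk fun i => ?_, mul_mem hu hk, fun i v hv => ?_⟩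
  · simpa [hkX] using (hb i).1
  · rw [AlgEquiv.mul_apply, hkX, map_sub u, sub_right_comm, map_sub, (hb i).2 v hv, sub_self]

theorem IsMeasuring.eq_one_of_coeff_eq_zero (hA : IsMeasuring A) {k : Aut n K}
    (hg : g ∈ unipotent K w) (hk : k ∈ G A)
    (h : ∀ i v, mono K v ∈ A i → coeff v (g (X i) - X i) = 0)
    (h_mul : ∀ i v, mono K v ∈ A i → coeff v ((g * k) (X i) - X i) = 0) : k = 1 := by
  refine algHom_ext_X fun i => sub_eq_zero.1 ?_
  refine (existsUnique_coeff_apply_eq hg (hA.isMonomial i) 0).unique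
    ⟨sub_mem ((hk i).map_mem (hA.X_mem i)) (hA.X_mem i), fun v hv => ?_⟩
    ⟨zero_mem _, fun v _ => by rw [map_zero]⟩
  have h_sub := congrArg₂ (· - ·) (h_mul i v hv) (h i v hv)
  simpa using h_sub

theorem IsMaxChain.exists_mem_reps (hB : IsMaxChain A B) (hA : IsMeasuring A)
    (hfin : ∀ i, {v : Fin n →₀ ℕ | mono K v ∉ A i}.Finite) {f : Aut n K} (hf : f ∈ G B) :
    ∃ g ∈ reps A B, ∃ h ∈ G A, f = g * h := by
  obtain ⟨u, hu, p, hp, rfl⟩ := hB.exists_eq_mul hA hf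
  obtain ⟨k, hk, h_unip, h_coeff⟩ := hA.exists_mul_coeff_eq_zero hu
  exact ⟨u * k, (hB.mem_reps_iff_mem_unipotent hfin).2 ⟨h_unip, h_coeff⟩,
    k⁻¹ * p, mul_mem (inv_mem hk) hp, by group⟩

theorem IsChain.eq_of_mul_eq_mul (hB : IsChain A B) (hA : IsMeasuring A)
    (hfin : ∀ i, {v : Fin n →₀ ℕ | mono K v ∉ A i}.Finite) {g' h h' : Aut n K}
    (hg : g ∈ reps A B) (hg' : g' ∈ reps A B) (hh : h ∈ G A) (hh' : h' ∈ G A)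
    (h_eq : g * h = g' * h') : g = g' := by
  rw [hB.mem_reps_iff_mem_unipotent hfin] at hg hg'
  have h_mul : g * (h * h'⁻¹) = g' := by rw [← mul_assoc, h_eq, mul_inv_cancel_right]
  have h_one := hA.eq_one_of_coeff_eq_zero hg.1 (mul_mem hh (inv_mem hh')) hg.2 (h_mul ▸ hg'.2)
  rw [← h_mul, h_one, mul_one]

end Representatives

end Alignment

theorem lemma3p3 {K : Type*} [Field K] {n r m : ℕ}
    (I : Fin r → Ideal (Alignment.PS n K))
    (hmon : ∀ k, Alignment.IsMonomial (I k))
    (hfin : ∀ k, FiniteDimensional K (Alignment.PS n K ⧸ I k))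
    (B : Fin (m + 1) → Ideal (Alignment.PS n K))
    (hB : Alignment.IsMaxChain (Alignment.measuring I) B) :
    Alignment.reps (Alignment.measuring I) B ⊆ (Alignment.G B : Set (Alignment.Aut n K)) ∧
    ∀ f ∈ Alignment.G B, ∃! g : Alignment.Aut n K,
      g ∈ Alignment.reps (Alignment.measuring I) B ∧
      ∃ h ∈ Alignment.G (Alignment.measuring I), f = g * h := by
  have hA := Alignment.isMeasuring_measuring hmon
  have hA_fin := Alignment.finite_setOf_mono_notMem_measuring hmon fun k =>
    Alignment.finite_setOf_mono_notMem (J := I k)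
  refine ⟨fun g hg => hB.unipotent_le ((hB.mem_reps_iff_mem_unipotent hA_fin).1 hg).1,
    fun f hf => ?_⟩
  obtain ⟨g, hg, h, hh, h_eq⟩ := hB.exists_mem_reps hA hA_fin hf
  refine ⟨g, ⟨hg, h, hh, h_eq⟩, ?_⟩
  rintro g' ⟨hg', h', hh', h_eq'⟩
  exact hB.eq_of_mul_eq_mul hA hA_fin hg' hg hh' hh (h_eq'.symm.trans h_eq)
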